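/- **Ray limits for mixed logit.** Let $J\ge 1$ be the number of inside goods, $\delta_1,\dots,\delta_J\in\mathbb R$ their mean utilities, $M>0$ the market size, and $F$ the law of a random price coefficient $\alpha$. Consider the mixed-logit demand system $$q_j(\mathbf p)=M\int\frac{\exp(\delta_j-\alpha p_j)}{1+\sum_{\ell=1}^J\exp(\delta_\ell-\alpha p_\ell)}\,dF(\alpha),\qquad j=1,\dots,J,$$ and set $$\delta_{jk}(\mathbf p)=-\frac{\partial_{p_k}q_j(\mathbf p)}{\partial_{p_j}q_j(\mathbf p)},\qquad \kappa^{j}_{kj}(\mathbf p)=\frac{q_j(\mathbf p)\,\partial_{p_jp_k}q_j(\mathbf p)}{\partial_{p_k}q_j(\mathbf p)\,\partial_{p_j}q_j(\mathbf p)}$$ (with $k=j$ allowed in the second formula). In both cases below, all partial derivatives appearing in these two expressions exist at every $\mathbf p\in\mathbb R_{++}^J$ and the denominators do not vanish there. Fix $\mathbf p\in\mathbb R_{++}^J$ and let $\mathbf p^{(n)}=\lambda_n\mathbf p$ with $\lambda_n\to\infty$. (a) *Log-normal mixing.* If $\alpha\sim\log\mathcal N(\mu,\sigma^2)$ with $\mu\in\mathbb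 R$, $\sigma>0$, then for each $j$ and each $k\ne j$ $$-2+\kappa^j_{jj}(\mathbf p^{(n)})\to-1,\qquad \delta_{jk}(\mathbf p^{(n)})\bigl(1-\kappa^j_{kj}(\mathbf p^{(n)})\bigr)\to0.$$ (b) *Gamma mixing.* Let $\alpha\sim\mathrm{Gamma}(r,\beta)$ with shape $r>0$ and rate $\beta>0$, and define $$H_j(\mathbf p)=\int_0^\infty z^{r-1}\frac{\exp(\delta_j-zp_j)}{1+\sum_{\ell}\exp(\delta_\ell-zp_\ell)}\,dz,\qquad C_j(\mathbf p)=\frac1{\Gamma(r)}\int_0^\infty\frac{u^{r-1}e^{-u}}{1+\sum_{\ell}\exp\bigl(\delta_\ell-\tfrac{p_\ell}{p_j}u\bigr)}\,du.$$ For $\mathbf p\in\mathbb R_{++}^J$ both integrals are finite, $C_j(\mathbf p)>0$, and $H_j(\mathbf p)=e^{\delta_j}\Gamma(r)p_j^{-r}C_j(\mathbf p)$. The derivatives in $$\zeta_j=-\frac{p_j}{r}\,\partial_{p_j}\log C_j,\qquad \chi_j=\frac{p_j^2}{r}\,\partial_{p_jp_j}\log C_j,\qquad \xi_{jk}=\frac{p_j^2}{r}\,\partial_{p_jp_k}\log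 C_j\quad(k\ne j)$$ exist on $\mathbb R_{++}^J$, $1+\zeta_j(\mathbf p)>0$, and for each $j$ and each $k\neq j$ $$-2+\kappa^j_{jj}(\mathbf p^{(n)})\to-1+\frac1r\,\frac{1+\chi_j(\mathbf p)}{(1+\zeta_j(\mathbf p))^2},\qquad \delta_{jk}(\mathbf p^{(n)})\bigl(1-\kappa^j_{kj}(\mathbf p^{(n)})\bigr)\to\frac1r\,\frac{\xi_{jk}(\mathbf p)}{(1+\zeta_j(\mathbf p))^2}.$$ If good $j$ has no competing inside goods ($J=1$), then $C_j$ is constant on $\mathbb R_{++}$, $\zeta_j=\chi_j=0$, and the diagonal limit is $-1+1/r$. If there are competing inside goods ($J\ge2$), then for all $j\ne k$ both limits depend on the ray, i.e. each of them, as a function of $\mathbf p\in\mathbb R_{++}^J$, is non-constant, and the off-diagonal limit is nonzero for some $\mathbf p\in\mathbb R_{++}^J$. -/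

import Mathlib

open Filter Topology MeasureTheory ProbabilityTheory

noncomputable section

namespace MixedLogit

variable {J : ℕ}

/-- The open positive orthant of price vectors. -/
def PosPrices (J : ℕ) : Set (Fin J → ℝ) := {p | ∀ i, 0 < p i}

/-- The partial derivative `∂f/∂p_i` at `p`. -/
def pderiv (i : Fin J) (f : (Fin J → ℝ) → ℝ) (p : Fin J → ℝ) : ℝ :=
  deriv (fun t => f (Function.update p i t)) (p i)

/-- The partial derivative `∂f/∂p_i` exists at `p`. -/
def HasPartialAt (i : Fin J) (f : (Fin J → ℝ) → ℝ) (p : Fin J → ℝ) : Prop :=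
  DifferentiableAt ℝ (fun t => f (Function.update p i t)) (p i)

/-- The logit choice probability of good `j` for a consumer with price coefficient `α`:
`exp (δ_j - α p_j) / (1 + ∑_ℓ exp (δ_ℓ - α p_ℓ))`. -/
def share (δ : Fin J → ℝ) (j : Fin J) (α : ℝ) (p : Fin J → ℝ) : ℝ :=
  Real.exp (δ j - α * p j) / (1 + ∑ l, Real.exp (δ l - α * p l))

/-- Mixed-logit demand with market size `M`, mean utilities `δ` and law `F` of the
price coefficient. -/
def demand (M : ℝ) (δ : Fin J → ℝ) (F : Measure ℝ) (j : Fin J) (p : Fin J → ℝ) : ℝ :=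
  M * ∫ α, share δ j α p ∂F

/-- The log-normal law: the law of `exp X` with `X` normal of mean `μ` and variance `σ ^ 2`. -/
def logNormal (μ σ : ℝ) : Measure ℝ :=
  (gaussianReal μ ⟨σ ^ 2, sq_nonneg σ⟩).map Real.exp

/-- The ratio `δ_{jk} = -(∂q_j/∂p_k) / (∂q_j/∂p_j)`. -/
def diversion (q : Fin J → (Fin J → ℝ) → ℝ) (j k : Fin J) (p : Fin J → ℝ) : ℝ :=
  -(pderiv k (q j) p / pderiv j (q j) p)

/-- The demand curvature `κ^i_{kj} = q_i (∂²q_i/∂p_j∂p_k) / ((∂q_i/∂p_k) (∂q_i/∂p_j))`. -/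
def curvature (q : Fin J → (Fin J → ℝ) → ℝ) (i k j : Fin J) (p : Fin J → ℝ) : ℝ :=
  q i p * pderiv j (pderiv k (q i)) p / (pderiv k (q i) p * pderiv j (q i) p)

/-- The diagonal term `-2 + κ^j_{jj}`. -/
def diagTerm (q : Fin J → (Fin J → ℝ) → ℝ) (j : Fin J) (p : Fin J → ℝ) : ℝ :=
  -2 + curvature q j j j p

/-- The off-diagonal term `δ_{jk} (1 - κ^j_{kj})`. -/
def offDiagTerm (q : Fin J → (Fin J → ℝ) → ℝ) (j k : Fin J) (p : Fin J → ℝ) : ℝ :=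
  diversion q j k p * (1 - curvature q j k j p)

/-- At every positive price vector the derivatives occurring in `diagTerm` and `offDiagTerm`
exist, and no denominator occurring there is zero. -/
def Regular (q : Fin J → (Fin J → ℝ) → ℝ) : Prop :=
  ∀ p ∈ PosPrices J, ∀ j k : Fin J,
    HasPartialAt k (q j) p ∧ HasPartialAt j (pderiv k (q j)) p ∧ pderiv k (q j) p ≠ 0

/-- `H_j(p) = ∫_0^∞ z^(r-1) Ψ_j(z; p) dz`, where `Ψ_j(z; p)` is `share δ j z p`. -/
def tailH (δ : Fin J → ℝ) (r : ℝ) (j : Fin J) (p : Fin J → ℝ) : ℝ :=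
  ∫ z in Set.Ioi (0 : ℝ), z ^ (r - 1) * share δ j z p

/-- The integrand of `C_j(p)`. -/
def kernelC (δ : Fin J → ℝ) (r : ℝ) (j : Fin J) (p : Fin J → ℝ) (u : ℝ) : ℝ :=
  u ^ (r - 1) * Real.exp (-u) / (1 + ∑ l, Real.exp (δ l - p l / p j * u))

/-- The market-interaction correction `C_j(p)`. -/
def tailC (δ : Fin J → ℝ) (r : ℝ) (j : Fin J) (p : Fin J → ℝ) : ℝ :=
  1 / Real.Gamma r * ∫ u in Set.Ioi (0 : ℝ), kernelC δ r j p u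

/-- `log C_j(p)`. -/
def logC (δ : Fin J → ℝ) (r : ℝ) (j : Fin J) (p : Fin J → ℝ) : ℝ :=
  Real.log (tailC δ r j p)

/-- `ζ_j(p) = -(p_j / r) ∂_{p_j} log C_j(p)`. -/
def zetaTerm (δ : Fin J → ℝ) (r : ℝ) (j : Fin J) (p : Fin J → ℝ) : ℝ :=
  -(p j / r) * pderiv j (logC δ r j) p

/-- `χ_j(p) = (p_j² / r) ∂_{p_j p_j} log C_j(p)`. -/
def chiTerm (δ : Fin J → ℝ) (r : ℝ) (j : Fin J) (p : Fin J → ℝ) : ℝ :=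
  p j ^ 2 / r * pderiv j (pderiv j (logC δ r j)) p

/-- `ξ_{jk}(p) = (p_j² / r) ∂_{p_j p_k} log C_j(p)`. -/
def xiTerm (δ : Fin J → ℝ) (r : ℝ) (j k : Fin J) (p : Fin J → ℝ) : ℝ :=
  p j ^ 2 / r * pderiv j (pderiv k (logC δ r j)) p

/-- The diagonal limit under gamma mixing, `-1 + (1/r) (1 + χ_j) / (1 + ζ_j)²`. -/
def gammaDiagLimit (δ : Fin J → ℝ) (r : ℝ) (j : Fin J) (p : Fin J → ℝ) : ℝ :=
  -1 + 1 / r * ((1 + chiTerm δ r j p) / (1 + zetaTerm δ r j p) ^ 2)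

/-- The off-diagonal limit under gamma mixing, `(1/r) ξ_{jk} / (1 + ζ_j)²`. -/
def gammaOffDiagLimit (δ : Fin J → ℝ) (r : ℝ) (j k : Fin J) (p : Fin J → ℝ) : ℝ :=
  1 / r * (xiTerm δ r j k p / (1 + zetaTerm δ r j p) ^ 2)

end MixedLogit

end

/-!
The term `δ_{jk} (1 - κ^j_{kj})` equals `∂_j ∂_k log q_j / (∂_j log q_j)²` and `-2 + κ^j_{jj}` is
one less than its value at `k = j`. Both are invariant under scaling of prices up to moving the
point of evaluation, so going out along a ray amounts to multiplying the price coefficient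
by `λ → ∞`.

A log-normal coefficient times `λ` is log-normal with `μ` replaced by `μ + log λ`. As `μ → ∞`,
exponential tilting shows that ratios of integrals converge to the limits at `α = ∞` of the ratios
of the integrands. Stein's lemma gives `μ ∫ α ^ m s_j ∼ σ² p_j ∫ α ^ (m + 1) s_j`, hence
`T₀ T₂ / T₁² → 1` for the moments `T_m = ∫ α ^ m s_j`, and this makes the numerator of the
logarithmic curvature negligible.

A gamma coefficient times `λ` is gamma with `β` replaced by `β / λ`. As `β → 0` its law, suitably
normalized, converges to `z ^ (r - 1) dz`, for which the demand is `H_j`; substituting `u = p_j z`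
writes `H_j` in terms of `C_j`. For the dependence on the ray, let only `p_j` vary. For `k ≠ j`
the positive function `∂_k log H_j` vanishes at `0` and at `∞`, so `∂_j ∂_k log H_j` takes both
signs. If the diagonal limit were constant, `u = ∂_j log H_j` would solve `u' = c u²` with
`1 / u → 0` at `0`, so `log C_j` would be a multiple of `log p_j` plus a constant; being bounded
above it would be constant, although `C_j` is strictly decreasing in `p_j`.
-/

namespace MixedLogit

variable {J : ℕ}

/-! ### Partial derivatives and logarithmic curvature -/

section PartialDerivatives

variable {p : Fin J → ℝ} {f g : (Fin J → ℝ) → ℝ} {i : Fin J}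

lemma update_mem_posPrices (hp : p ∈ PosPrices J) (i : Fin J) {t : ℝ} (ht : 0 < t) :
    Function.update p i t ∈ PosPrices J := by
  intro l
  obtain rfl | hl := eq_or_ne l i
  · simpa using ht
  · simpa [Function.update_of_ne hl] using hp l

lemma smul_mem_posPrices (hp : p ∈ PosPrices J) {x : ℝ} (hx : 0 < x) : x • p ∈ PosPrices J :=
  fun l => mul_pos hx (hp l)

lemma eventually_update_mem_posPrices (hp : p ∈ PosPrices J) (i : Fin J) :
    ∀ᶠ t in 𝓝 (p i), Function.update p i t ∈ PosPrices J :=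
  (eventually_gt_nhds (hp i)).mono fun _ ht => update_mem_posPrices hp i ht

lemma HasPartialAt.hasDerivAt (h : HasPartialAt i f p) :
    HasDerivAt (fun t => f (Function.update p i t)) (pderiv i f p) (p i) :=
  DifferentiableAt.hasDerivAt h

lemma HasPartialAt.hasDerivAt_update {t : ℝ} (h : HasPartialAt i f (Function.update p i t)) :
    HasDerivAt (fun t => f (Function.update p i t)) (pderiv i f (Function.update p i t)) t := by
  simpa using h.hasDerivAt

lemma eventuallyEq_update_of_eqOn_posPrices (h : Set.EqOn f g (PosPrices J))
    (hp : p ∈ PosPrices J) (i : Fin J) :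
    (fun t => f (Function.update p i t)) =ᶠ[𝓝 (p i)] fun t => g (Function.update p i t) :=
  (eventually_update_mem_posPrices hp i).mono fun _ ht => h ht

lemma pderiv_eqOn_posPrices (h : Set.EqOn f g (PosPrices J)) (i : Fin J) :
    Set.EqOn (pderiv i f) (pderiv i g) (PosPrices J) := fun _ hp =>
  (eventuallyEq_update_of_eqOn_posPrices h hp i).deriv_eq

lemma pderiv_comp_smul (i : Fin J) (f : (Fin J → ℝ) → ℝ) (x : ℝ) (p : Fin J → ℝ) :
    pderiv i (fun p => f (x • p)) p = x * pderiv i f (x • p) := by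
  have hupdate (t : ℝ) : x • Function.update p i t = Function.update (x • p) i (x * t) :=
    (Function.update_smul x p i t).symm
  simp only [pderiv, hupdate]
  exact deriv_comp_mul_left x (fun t => f (Function.update (x • p) i t)) (p i)

end PartialDerivatives

section LogDemand

variable {q : Fin J → (Fin J → ℝ) → ℝ} {j k : Fin J} {p : Fin J → ℝ}

lemma diagTerm_eq_offDiagTerm_sub_one (h : pderiv j (q j) p ≠ 0) :
    diagTerm q j p = offDiagTerm q j j p - 1 := by
  rw [diagTerm, offDiagTerm, diversion, div_self h]
  ring

lemma tendsto_diagTerm_of_tendsto_offDiagTerm (hq : Regular q) (hp : p ∈ PosPrices J) {L : ℝ}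
    (h : Tendsto (fun x : ℝ => offDiagTerm q j j (x • p)) atTop (𝓝 L)) :
    Tendsto (fun x : ℝ => diagTerm q j (x • p)) atTop (𝓝 (L - 1)) :=
  (h.sub_const 1).congr' <| (eventually_gt_atTop 0).mono fun _ hx =>
    (diagTerm_eq_offDiagTerm_sub_one (hq _ (smul_mem_posPrices hp hx) j j).2.2).symm

lemma offDiagTerm_eq_div_sq (hk : pderiv k (q j) p ≠ 0) (hj : pderiv j (q j) p ≠ 0) :
    offDiagTerm q j k p =
      (q j p * pderiv j (pderiv k (q j)) p - pderiv k (q j) p * pderiv j (q j) p) /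
        pderiv j (q j) p ^ 2 := by
  rw [offDiagTerm, diversion, curvature]
  field_simp
  ring

lemma offDiagTerm_comp_smul (q : Fin J → (Fin J → ℝ) → ℝ) (j k : Fin J) {x : ℝ} (hx : x ≠ 0)
    (p : Fin J → ℝ) :
    offDiagTerm (fun l p => q l (x • p)) j k p = offDiagTerm q j k (x • p) := by
  have hkk : pderiv k (fun p => q j (x • p)) = fun p => x * pderiv k (q j) (x • p) :=
    funext (pderiv_comp_smul k (q j) x)
  have hjk : pderiv j (pderiv k fun p => q j (x • p)) p =
      x * (x * pderiv j (pderiv k (q j)) (x • p)) := by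
    rw [hkk, ← pderiv_comp_smul]
    exact deriv_const_mul_field x
  simp only [offDiagTerm, diversion, curvature, hjk, pderiv_comp_smul]
  field_simp

/-- The logarithm of the demand for good `j`. Both `diagTerm` and `offDiagTerm` are ratios of its
second derivatives to the square of its own-price derivative. -/
noncomputable def logDemand (q : Fin J → (Fin J → ℝ) → ℝ) (j : Fin J) (p : Fin J → ℝ) : ℝ :=
  Real.log (q j p)

lemma hasDerivAt_logDemand (hq : Regular q) (hpos : ∀ p ∈ PosPrices J, 0 < q j p)
    (hp : p ∈ PosPrices J) (k : Fin J) :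
    HasDerivAt (fun t => logDemand q j (Function.update p k t))
      (pderiv k (q j) p / q j p) (p k) := by
  have hlog := (hq p hp j k).1.hasDerivAt.log (by simpa using (hpos p hp).ne')
  rwa [Function.update_eq_self] at hlog

lemma pderiv_logDemand (hq : Regular q) (hpos : ∀ p ∈ PosPrices J, 0 < q j p)
    (hp : p ∈ PosPrices J) (k : Fin J) :
    pderiv k (logDemand q j) p = pderiv k (q j) p / q j p :=
  (hasDerivAt_logDemand hq hpos hp k).deriv

lemma hasDerivAt_pderiv_logDemand (hq : Regular q) (hpos : ∀ p ∈ PosPrices J, 0 < q j p)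
    (hp : p ∈ PosPrices J) (k : Fin J) :
    HasDerivAt (fun t => pderiv k (logDemand q j) (Function.update p j t))
      ((q j p * pderiv j (pderiv k (q j)) p - pderiv k (q j) p * pderiv j (q j) p) / q j p ^ 2)
      (p j) := by
  have hquot := (hq p hp j k).2.1.hasDerivAt.div (hq p hp j j).1.hasDerivAt
    (by simpa using (hpos p hp).ne')
  simp only [Function.update_eq_self, mul_comm _ (q j p)] at hquot
  exact hquot.congr_of_eventuallyEq ((eventually_update_mem_posPrices hp j).mono fun t ht =>
    pderiv_logDemand hq hpos ht k)

lemma hasPartialAt_logDemand (hq : Regular q) (hpos : ∀ p ∈ PosPrices J, 0 < q j p)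
    (hp : p ∈ PosPrices J) (k : Fin J) : HasPartialAt k (logDemand q j) p :=
  (hasDerivAt_logDemand hq hpos hp k).differentiableAt

lemma hasPartialAt_pderiv_logDemand (hq : Regular q) (hpos : ∀ p ∈ PosPrices J, 0 < q j p)
    (hp : p ∈ PosPrices J) (k : Fin J) : HasPartialAt j (pderiv k (logDemand q j)) p :=
  (hasDerivAt_pderiv_logDemand hq hpos hp k).differentiableAt

lemma offDiagTerm_eq_logDemand (hq : Regular q) (hpos : ∀ p ∈ PosPrices J, 0 < q j p)
    (hp : p ∈ PosPrices J) (k : Fin J) :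
    offDiagTerm q j k p =
      pderiv j (pderiv k (logDemand q j)) p / pderiv j (logDemand q j) p ^ 2 := by
  have hjk : pderiv j (pderiv k (logDemand q j)) p = _ :=
    (hasDerivAt_pderiv_logDemand hq hpos hp k).deriv
  have hq0 := (hpos p hp).ne'
  rw [offDiagTerm_eq_div_sq (hq p hp j k).2.2 (hq p hp j j).2.2, hjk,
    pderiv_logDemand hq hpos hp, div_pow, div_div_div_cancel_right₀ (pow_ne_zero 2 hq0)]

end LogDemand

/-! ### Logit shares -/

section Share

variable (δ : Fin J → ℝ) (j k : Fin J) (α : ℝ) (p : Fin J → ℝ)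

lemma logit_denom_pos : 0 < 1 + ∑ l, Real.exp (δ l - α * p l) := by positivity

lemma share_pos : 0 < share δ j α p :=
  div_pos (Real.exp_pos _) (logit_denom_pos δ α p)

lemma share_lt_one : share δ j α p < 1 := by
  rw [share, div_lt_one (logit_denom_pos δ α p)]
  have hj := Finset.single_le_sum (f := fun l => Real.exp (δ l - α * p l))
    (fun _ _ => (Real.exp_pos _).le) (Finset.mem_univ j)
  linarith

lemma share_le_exp : share δ j α p ≤ Real.exp (δ j) * Real.exp (-(p j * α)) := by
  rw [← Real.exp_add, ← sub_eq_add_neg, mul_comm (p j)]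
  exact div_le_self (Real.exp_pos _).le (le_add_of_nonneg_right (by positivity))

lemma continuous_share : Continuous fun α => share δ j α p :=
  Continuous.div (by fun_prop) (by fun_prop) fun α => (logit_denom_pos δ α p).ne'

lemma tendsto_share_atTop {p : Fin J → ℝ} (hp : p ∈ PosPrices J) :
    Tendsto (fun α => share δ j α p) atTop (𝓝 0) := by
  refine squeeze_zero (fun α => (share_pos δ j α p).le) (fun α => share_le_exp δ j α p) ?_
  simpa using (Real.tendsto_exp_neg_atTop_nhds_zero.comp
    (tendsto_id.const_mul_atTop (hp j))).const_mul (Real.exp (δ j))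

/-- The derivative of `share δ j α` in the price of good `k`. -/
noncomputable def shareDeriv : ℝ :=
  α * (share δ j α p * (share δ k α p - if k = j then 1 else 0))

/-- The mixed derivative of `share δ j α` in the prices of goods `j` and `k`. -/
noncomputable def shareDeriv₂ : ℝ :=
  α ^ 2 * (share δ j α p * ((share δ j α p - 1) * (share δ k α p - if k = j then 1 else 0) +
    share δ k α p * (share δ j α p - if k = j then 1 else 0)))

lemma continuous_shareDeriv : Continuous fun α => shareDeriv δ j k α p := by
  have hj := continuous_share δ j p
  have hk := continuous_share δ k p
  unfold shareDeriv
  fun_prop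

lemma continuous_shareDeriv₂ : Continuous fun α => shareDeriv₂ δ j k α p := by
  have hj := continuous_share δ j p
  have hk := continuous_share δ k p
  unfold shareDeriv₂
  fun_prop

lemma hasDerivAt_share (t : ℝ) :
    HasDerivAt (fun t => share δ j α (Function.update p k t))
      (shareDeriv δ j k α (Function.update p k t)) t := by
  have hexp (l : Fin J) : HasDerivAt (fun t => Real.exp (δ l - α * Function.update p k t l))
      (if l = k then -α * Real.exp (δ l - α * Function.update p k t l) else 0) t := by
    obtain rfl | hl := eq_or_ne l k
    · simp only [Function.update_self, if_true]
      convert (((hasDerivAt_id' t).const_mul α).const_sub (δ l)).exp using 1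
      ring
    · simpa only [Function.update_of_ne hl, if_neg hl] using hasDerivAt_const t _
  have hdenom : HasDerivAt (fun t => 1 + ∑ l, Real.exp (δ l - α * Function.update p k t l))
      (-α * Real.exp (δ k - α * Function.update p k t k)) t := by
    simpa using (HasDerivAt.fun_sum (u := Finset.univ) fun l _ => hexp l).const_add 1
  have hpos := logit_denom_pos δ α (Function.update p k t)
  refine ((hexp j).div hdenom hpos.ne').congr_deriv ?_
  simp only [shareDeriv, share, eq_comm (a := k) (b := j)]
  split_ifs with hjk
  · subst hjk
    field_simp
    ring
  · field_simp
    ring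

lemma hasDerivAt_shareDeriv (t : ℝ) :
    HasDerivAt (fun t => shareDeriv δ j k α (Function.update p j t))
      (shareDeriv₂ δ j k α (Function.update p j t)) t := by
  refine (((hasDerivAt_share δ j j α p t).mul
    ((hasDerivAt_share δ k j α p t).sub_const (if k = j then (1 : ℝ) else 0))).const_mul
      α).congr_deriv ?_
  simp only [shareDeriv, shareDeriv₂, if_true, eq_comm (a := j) (b := k)]
  ring

lemma abs_share_sub_ite_le (l : Fin J) : |share δ l α p - if k = j then 1 else 0| ≤ 1 := by
  have h0 := share_pos δ l α p
  have h1 := share_lt_one δ l α p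
  rw [abs_le]
  split_ifs <;> constructor <;> linarith

lemma abs_shareDeriv_le {α : ℝ} (hα : 0 < α) :
    |shareDeriv δ j k α p| ≤ α * share δ j α p := by
  rw [shareDeriv, abs_mul, abs_of_pos hα, abs_mul, abs_of_pos (share_pos δ j α p)]
  exact mul_le_mul_of_nonneg_left
    (mul_le_of_le_one_right (share_pos δ j α p).le (abs_share_sub_ite_le δ j k α p k)) hα.le

lemma abs_shareDeriv₂_le : |shareDeriv₂ δ j k α p| ≤ 2 * (α ^ 2 * share δ j α p) := by
  have hpos := share_pos δ j α p
  have hone : |share δ j α p - 1| ≤ 1 := by simpa using abs_share_sub_ite_le δ j j α p j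
  have hk : |share δ k α p| ≤ 1 := by
    rw [abs_of_pos (share_pos δ k α p)]
    exact (share_lt_one δ k α p).le
  rw [shareDeriv₂, abs_mul, abs_of_nonneg (sq_nonneg α), abs_mul, abs_of_pos hpos]
  calc _ ≤ α ^ 2 * (share δ j α p * (1 * 1 + 1 * 1)) := by
        refine mul_le_mul_of_nonneg_left (mul_le_mul_of_nonneg_left
          ((abs_add_le _ _).trans ?_) hpos.le) (sq_nonneg α)
        rw [abs_mul, abs_mul]
        gcongr <;> exact abs_share_sub_ite_le δ j k α p _
    _ = _ := by ring

lemma shareDeriv_self_neg {α : ℝ} (hα : 0 < α) : shareDeriv δ j j α p < 0 := by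
  rw [shareDeriv, if_pos rfl]
  exact mul_neg_of_pos_of_neg hα (mul_neg_of_pos_of_neg (share_pos δ j α p)
    (sub_neg.2 (share_lt_one δ j α p)))

lemma shareDeriv_pos {j k : Fin J} (hkj : k ≠ j) {α : ℝ} (hα : 0 < α) :
    0 < shareDeriv δ j k α p := by
  rw [shareDeriv, if_neg hkj, sub_zero]
  exact mul_pos hα (mul_pos (share_pos δ j α p) (share_pos δ k α p))

end Share

/-! ### Demand under a general mixing measure -/

lemma integral_pos_of_ae_pos {Ω : Type*} {mΩ : MeasurableSpace Ω} {ν : Measure Ω} {g : Ω → ℝ}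
    (hν : ν ≠ 0) (hg : Integrable g ν) (hpos : ∀ᵐ ω ∂ν, 0 < g ω) : 0 < ∫ ω, g ω ∂ν := by
  rw [integral_pos_iff_support_of_nonneg_ae (hpos.mono fun _ h => h.le) hg, pos_iff_ne_zero]
  intro hzero
  have hfalse : ∀ᵐ _ ∂ν, False := by
    filter_upwards [hpos, measure_eq_zero_iff_ae_notMem.1 hzero] with ω hω hω'
    exact hω' hω.ne'
  exact hν (by simpa using hfalse)

section Mixing

/-- Nonzero measures on the positive half-line all of whose exponential moments of negative order
are finite. These are the mixing measures, not necessarily finite, for which mixed-logit demand is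
finite at all positive prices. -/
structure IsMixing (F : Measure ℝ) : Prop where
  pos : ∀ᵐ α ∂F, 0 < α
  integrable_exp : ∀ c : ℝ, 0 < c → Integrable (fun α => Real.exp (-(c * α))) F
  ne_zero : F ≠ 0

variable {F : Measure ℝ} {p : Fin J → ℝ}

lemma isMixing_of_isFiniteMeasure [IsFiniteMeasure F] (hpos : ∀ᵐ α ∂F, 0 < α) (hF : F ≠ 0) :
    IsMixing F where
  pos := hpos
  ne_zero := hF
  integrable_exp c hc := by
    refine Integrable.of_bound (C := 1) (by fun_prop) ?_
    filter_upwards [hpos] with α hα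
    rw [Real.norm_eq_abs, Real.abs_exp, Real.exp_le_one_iff]
    nlinarith

lemma IsMixing.integral_pos (hF : IsMixing F) {g : ℝ → ℝ} (hg : Integrable g F)
    (hpos : ∀ α, 0 < α → 0 < g α) : 0 < ∫ α, g α ∂F :=
  integral_pos_of_ae_pos hF.ne_zero hg (hF.pos.mono hpos)

lemma pow_le_exp_half_mul {c α : ℝ} (hc : 0 < c) (hα : 0 ≤ α) (m : ℕ) :
    α ^ m ≤ m.factorial / (c / 2) ^ m * Real.exp (c / 2 * α) := by
  have h := Real.pow_div_factorial_le_exp (c / 2 * α) (by positivity) m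
  rw [div_le_iff₀ (by positivity), mul_pow] at h
  rw [div_mul_eq_mul_div, le_div_iff₀ (by positivity)]
  linarith

lemma IsMixing.integrable_pow_mul_exp (hF : IsMixing F) (m : ℕ) {c : ℝ} (hc : 0 < c) :
    Integrable (fun α => α ^ m * Real.exp (-(c * α))) F := by
  refine ((hF.integrable_exp (c / 2) (half_pos hc)).const_mul
    (m.factorial / (c / 2) ^ m)).mono' (by fun_prop) ?_
  filter_upwards [hF.pos] with α hα
  rw [Real.norm_eq_abs, abs_of_nonneg (by positivity)]
  calc α ^ m * Real.exp (-(c * α))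
      ≤ m.factorial / (c / 2) ^ m * Real.exp (c / 2 * α) * Real.exp (-(c * α)) := by
        gcongr
        exact pow_le_exp_half_mul hc hα.le m
    _ = m.factorial / (c / 2) ^ m * Real.exp (-(c / 2 * α)) := by
        rw [mul_assoc, ← Real.exp_add]
        ring_nf

lemma IsMixing.integrable_pow_mul_share (hF : IsMixing F) (δ : Fin J → ℝ) (j : Fin J)
    (hp : p ∈ PosPrices J) (m : ℕ) : Integrable (fun α => α ^ m * share δ j α p) F := by
  have hcont := continuous_share δ j p
  refine ((hF.integrable_pow_mul_exp m (hp j)).const_mul (Real.exp (δ j))).mono'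
    (by fun_prop) ?_
  filter_upwards [hF.pos] with α hα
  have hshare := share_pos δ j α p
  rw [Real.norm_eq_abs, abs_of_pos (by positivity), mul_left_comm]
  exact mul_le_mul_of_nonneg_left (share_le_exp δ j α p) (by positivity)

lemma IsMixing.integrable_share (hF : IsMixing F) (δ : Fin J → ℝ) (j : Fin J)
    (hp : p ∈ PosPrices J) : Integrable (fun α => share δ j α p) F := by
  simpa using hF.integrable_pow_mul_share δ j hp 0

lemma IsMixing.integrable_shareDeriv (hF : IsMixing F) (δ : Fin J → ℝ) (j k : Fin J)
    (hp : p ∈ PosPrices J) : Integrable (fun α => shareDeriv δ j k α p) F :=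
  (hF.integrable_pow_mul_share δ j hp 1).mono'
    (continuous_shareDeriv δ j k p).aestronglyMeasurable
    (hF.pos.mono fun _ hα => by simpa using abs_shareDeriv_le δ j k p hα)

lemma half_le_update_apply (hp : p ∈ PosPrices J) (i j : Fin J) {t : ℝ}
    (ht : p i / 2 < t) : p j / 2 ≤ Function.update p i t j := by
  obtain rfl | hj := eq_or_ne j i
  · simpa using ht.le
  · rw [Function.update_of_ne hj]
    linarith [hp j]

lemma IsMixing.hasDerivAt_integral (hF : IsMixing F) {f f' : ℝ → (Fin J → ℝ) → ℝ}
    {δ : Fin J → ℝ} {i j : Fin J} {C : ℝ} {m : ℕ} (hp : p ∈ PosPrices J)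
    (hf : ∀ p, Continuous fun α => f α p) (hf' : Continuous fun α => f' α p)
    (hint : Integrable (fun α => f α p) F) (hC : 0 ≤ C)
    (hbound : ∀ α, 0 < α → ∀ p, |f' α p| ≤ C * (α ^ m * share δ j α p))
    (hderiv : ∀ α t, HasDerivAt (fun t => f α (Function.update p i t))
      (f' α (Function.update p i t)) t) :
    HasDerivAt (fun t => ∫ α, f α (Function.update p i t) ∂F) (∫ α, f' α p ∂F) (p i) := by
  have hbound_nhds : ∀ᵐ α ∂F, ∀ t ∈ Set.Ioi (p i / 2), ‖f' α (Function.update p i t)‖ ≤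
      C * Real.exp (δ j) * (α ^ m * Real.exp (-(p j / 2 * α))) := by
    filter_upwards [hF.pos] with α hα t ht
    calc ‖f' α (Function.update p i t)‖
        ≤ C * (α ^ m * share δ j α (Function.update p i t)) := hbound α hα _
      _ ≤ C * (α ^ m * (Real.exp (δ j) * Real.exp (-(Function.update p i t j * α)))) := by
          gcongr
          exact share_le_exp δ j α _
      _ ≤ C * (α ^ m * (Real.exp (δ j) * Real.exp (-(p j / 2 * α)))) := by
          gcongr
          exact half_le_update_apply hp i j ht
      _ = _ := by ring
  have h := hasDerivAt_integral_of_dominated_loc_of_deriv_le (μ := F)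
    (F := fun t α => f α (Function.update p i t)) (F' := fun t α => f' α (Function.update p i t))
    (Ioi_mem_nhds (half_lt_self (hp i)))
    (Eventually.of_forall fun t => (hf _).aestronglyMeasurable) (by simpa using hint)
    (by simpa using hf'.aestronglyMeasurable) hbound_nhds
    ((hF.integrable_pow_mul_exp m (half_pos (hp j))).const_mul _)
    (Eventually.of_forall fun α t _ => hderiv α t)
  simpa only [Function.update_eq_self] using h.2

lemma IsMixing.hasDerivAt_demand (hF : IsMixing F) (M : ℝ) (δ : Fin J → ℝ) (j k : Fin J)
    (hp : p ∈ PosPrices J) :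
    HasDerivAt (fun t => demand M δ F j (Function.update p k t))
      (M * ∫ α, shareDeriv δ j k α p ∂F) (p k) :=
  (hF.hasDerivAt_integral hp (continuous_share δ j) (continuous_shareDeriv δ j k p)
    (hF.integrable_share δ j hp) zero_le_one (m := 1)
    (fun _ hα p => by simpa using abs_shareDeriv_le δ j k p hα)
    fun α t => hasDerivAt_share δ j k α p t).const_mul M

lemma IsMixing.pderiv_demand (hF : IsMixing F) (M : ℝ) (δ : Fin J → ℝ) (j k : Fin J)
    (hp : p ∈ PosPrices J) :
    pderiv k (demand M δ F j) p = M * ∫ α, shareDeriv δ j k α p ∂F :=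
  (hF.hasDerivAt_demand M δ j k hp).deriv

lemma IsMixing.hasDerivAt_pderiv_demand (hF : IsMixing F) (M : ℝ) (δ : Fin J → ℝ)
    (j k : Fin J) (hp : p ∈ PosPrices J) :
    HasDerivAt (fun t => pderiv k (demand M δ F j) (Function.update p j t))
      (M * ∫ α, shareDeriv₂ δ j k α p ∂F) (p j) :=
  ((hF.hasDerivAt_integral hp (continuous_shareDeriv δ j k) (continuous_shareDeriv₂ δ j k p)
    (hF.integrable_shareDeriv δ j k hp) zero_le_two (fun α _ => abs_shareDeriv₂_le δ j k α)
    fun α t => hasDerivAt_shareDeriv δ j k α p t).const_mul M).congr_of_eventuallyEq <|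
  (eventually_update_mem_posPrices hp j).mono fun _ ht => hF.pderiv_demand M δ j k ht

lemma IsMixing.demand_pos (hF : IsMixing F) {M : ℝ} (hM : 0 < M) (δ : Fin J → ℝ) (j : Fin J)
    (hp : p ∈ PosPrices J) : 0 < demand M δ F j p :=
  mul_pos hM (hF.integral_pos (hF.integrable_share δ j hp) fun α _ => share_pos δ j α p)

lemma IsMixing.integral_shareDeriv_self_neg (hF : IsMixing F) (δ : Fin J → ℝ) (j : Fin J)
    (hp : p ∈ PosPrices J) : ∫ α, shareDeriv δ j j α p ∂F < 0 := by
  have h := hF.integral_pos (hF.integrable_shareDeriv δ j j hp).neg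
    fun α hα => neg_pos.2 (shareDeriv_self_neg δ j p hα)
  simpa only [Pi.neg_apply, integral_neg, Left.neg_pos_iff] using h

lemma IsMixing.integral_shareDeriv_pos (hF : IsMixing F) (δ : Fin J → ℝ) {j k : Fin J}
    (hkj : k ≠ j) (hp : p ∈ PosPrices J) : 0 < ∫ α, shareDeriv δ j k α p ∂F :=
  hF.integral_pos (hF.integrable_shareDeriv δ j k hp) fun _ hα => shareDeriv_pos δ p hkj hα

lemma IsMixing.integral_shareDeriv_ne_zero (hF : IsMixing F) (δ : Fin J → ℝ) (j k : Fin J)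
    (hp : p ∈ PosPrices J) : ∫ α, shareDeriv δ j k α p ∂F ≠ 0 := by
  obtain rfl | hkj := eq_or_ne k j
  · exact (hF.integral_shareDeriv_self_neg δ k hp).ne
  · exact (hF.integral_shareDeriv_pos δ hkj hp).ne'

theorem IsMixing.regular_demand (hF : IsMixing F) {M : ℝ} (hM : M ≠ 0) (δ : Fin J → ℝ) :
    Regular (demand M δ F) := fun p hp j k =>
  ⟨(hF.hasDerivAt_demand M δ j k hp).differentiableAt,
    (hF.hasDerivAt_pderiv_demand M δ j k hp).differentiableAt, by
    rw [hF.pderiv_demand M δ j k hp]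
    exact mul_ne_zero hM (hF.integral_shareDeriv_ne_zero δ j k hp)⟩

theorem IsMixing.offDiagTerm_demand (hF : IsMixing F) {M : ℝ} (hM : M ≠ 0) (δ : Fin J → ℝ)
    (j k : Fin J) (hp : p ∈ PosPrices J) :
    offDiagTerm (demand M δ F) j k p =
      ((∫ α, share δ j α p ∂F) * (∫ α, shareDeriv₂ δ j k α p ∂F) -
        (∫ α, shareDeriv δ j k α p ∂F) * ∫ α, shareDeriv δ j j α p ∂F) /
        (∫ α, shareDeriv δ j j α p ∂F) ^ 2 := by
  have hreg := hF.regular_demand hM δ p hp j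
  have hjk : pderiv j (pderiv k (demand M δ F j)) p = _ :=
    (hF.hasDerivAt_pderiv_demand M δ j k hp).deriv
  have hself := hF.integral_shareDeriv_ne_zero δ j j hp
  rw [offDiagTerm_eq_div_sq (hreg k).2.2 (hreg j).2.2, hjk, hF.pderiv_demand M δ j k hp,
    hF.pderiv_demand M δ j j hp, demand]
  field_simp

lemma demand_smul (M : ℝ) (δ : Fin J → ℝ) (F : Measure ℝ) (j : Fin J) (x : ℝ) (p : Fin J → ℝ) :
    demand M δ F j (x • p) = demand M δ (F.map (x * ·)) j p := by
  rw [demand, demand, integral_map (by fun_prop) (continuous_share δ j p).aestronglyMeasurable]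
  simp only [share, Pi.smul_apply, smul_eq_mul, mul_assoc, mul_left_comm]

theorem offDiagTerm_demand_smul (M : ℝ) (δ : Fin J → ℝ) (F : Measure ℝ) (j k : Fin J) {x : ℝ}
    (hx : x ≠ 0) (p : Fin J → ℝ) :
    offDiagTerm (demand M δ F) j k (x • p) = offDiagTerm (demand M δ (F.map (x * ·))) j k p := by
  have hq : (fun l p => demand M δ F l (x • p)) = demand M δ (F.map (x * ·)) :=
    funext fun l => funext (demand_smul M δ F l x)
  rw [← offDiagTerm_comp_smul _ j k hx, hq]

end Mixing

/-! ### Exponential tilting -/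

section Tilting

variable {Ω : Type*} {mΩ : MeasurableSpace Ω} {ν : Measure Ω} {X u w : Ω → ℝ}

lemma exp_mul_mul_setIntegral_le_integral (hw : ∀ ω, 0 < w ω)
    (hw_int : ∀ a : ℝ, Integrable (fun ω => Real.exp (a * X ω) * w ω) ν) {K : ℝ}
    (hK : MeasurableSet {ω | K ≤ X ω}) {a : ℝ} (ha : 0 ≤ a) :
    Real.exp (a * K) * ∫ ω in {ω | K ≤ X ω}, w ω ∂ν ≤ ∫ ω, Real.exp (a * X ω) * w ω ∂ν := by
  have hw_int₀ : Integrable w ν := by simpa using hw_int 0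
  calc Real.exp (a * K) * ∫ ω in {ω | K ≤ X ω}, w ω ∂ν
      = ∫ ω in {ω | K ≤ X ω}, Real.exp (a * K) * w ω ∂ν := (integral_const_mul _ _).symm
    _ ≤ ∫ ω in {ω | K ≤ X ω}, Real.exp (a * X ω) * w ω ∂ν := by
        refine setIntegral_mono_on (hw_int₀.const_mul _).integrableOn
          (hw_int a).integrableOn hK fun ω (hXω : K ≤ X ω) => ?_
        have := hw ω
        gcongr
    _ ≤ _ := setIntegral_le_integral (hw_int a)
        (Eventually.of_forall fun ω => (mul_pos (Real.exp_pos _) (hw ω)).le)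

lemma isLittleO_exp_mul_integral_exp_mul (hw : ∀ ω, 0 < w ω)
    (hw_int : ∀ a : ℝ, Integrable (fun ω => Real.exp (a * X ω) * w ω) ν)
    (hX : Measurable X) (hX_unbounded : ∀ K, ν {ω | K ≤ X ω} ≠ 0) (K : ℝ) :
    (fun a => Real.exp (a * K)) =o[atTop] fun a => ∫ ω, Real.exp (a * X ω) * w ω ∂ν := by
  have hmeas : MeasurableSet {ω | K + 1 ≤ X ω} := measurableSet_le measurable_const hX
  have hmass : 0 < ∫ ω in {ω | K + 1 ≤ X ω}, w ω ∂ν := by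
    have hw_int₀ : Integrable w ν := by simpa using hw_int 0
    exact integral_pos_of_ae_pos (Measure.restrict_eq_zero.not.2 (hX_unbounded _))
      hw_int₀.integrableOn (Eventually.of_forall hw)
  have hexp : (fun a => Real.exp (a * K)) =o[atTop] fun a => Real.exp (a * (K + 1)) := by
    rw [Real.isLittleO_exp_comp_exp_comp]
    exact tendsto_id.congr fun a => by simp only [id, mul_add, mul_one, add_sub_cancel_left]
  refine hexp.trans_isBigO (Asymptotics.IsBigO.of_bound (∫ ω in {ω | K + 1 ≤ X ω}, w ω ∂ν)⁻¹ ?_)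
  filter_upwards [eventually_ge_atTop 0] with a ha
  rw [Real.norm_eq_abs, Real.abs_exp, inv_mul_eq_div, le_div_iff₀ hmass]
  exact (exp_mul_mul_setIntegral_le_integral hw hw_int hmeas ha).trans (le_abs_self _)

lemma abs_integral_exp_mul_le {K ε : ℝ} (hw : ∀ ω, 0 < w ω) (hε : 0 ≤ ε)
    (hw_int : ∀ a : ℝ, Integrable (fun ω => Real.exp (a * X ω) * w ω) ν) (hu_int : Integrable u ν)
    (hu : ∀ ω, K ≤ X ω → |u ω| ≤ ε * |w ω|) {a : ℝ} (ha : 0 ≤ a) :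
    |∫ ω, Real.exp (a * X ω) * u ω ∂ν| ≤
      Real.exp (a * K) * ∫ ω, |u ω| ∂ν + ε * ∫ ω, Real.exp (a * X ω) * w ω ∂ν := by
  rw [← integral_const_mul, ← integral_const_mul,
    ← integral_add (hu_int.abs.const_mul _) ((hw_int a).const_mul _), ← Real.norm_eq_abs]
  refine norm_integral_le_of_norm_le ((hu_int.abs.const_mul _).add ((hw_int a).const_mul _))
    (Eventually.of_forall fun ω => ?_)
  have hω := hw ω
  rw [norm_mul, Real.norm_eq_abs, Real.norm_eq_abs, Real.abs_exp]
  rcases le_total K (X ω) with hXω | hXω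
  · have hle := mul_le_mul_of_nonneg_left (hu ω hXω) (Real.exp_pos (a * X ω)).le
    rw [abs_of_pos hω] at hle
    have hnonneg : 0 ≤ Real.exp (a * K) * |u ω| := by positivity
    linarith
  · have hle : Real.exp (a * X ω) * |u ω| ≤ Real.exp (a * K) * |u ω| := by gcongr
    have hnonneg : 0 ≤ ε * (Real.exp (a * X ω) * w ω) := by positivity
    linarith

theorem isLittleO_integral_exp_mul (hw : ∀ ω, 0 < w ω)
    (hw_int : ∀ a : ℝ, Integrable (fun ω => Real.exp (a * X ω) * w ω) ν) (hu_int : Integrable u ν)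
    (hX : Measurable X) (hX_unbounded : ∀ K, ν {ω | K ≤ X ω} ≠ 0)
    (huw : u =o[comap X atTop] w) :
    (fun a => ∫ ω, Real.exp (a * X ω) * u ω ∂ν) =o[atTop]
      fun a => ∫ ω, Real.exp (a * X ω) * w ω ∂ν := by
  refine Asymptotics.isLittleO_iff.2 fun ε hε => ?_
  obtain ⟨K, hK⟩ := eventually_atTop.1
    (eventually_comap.1 (Asymptotics.isLittleO_iff.1 huw (half_pos hε)))
  have hsmall := Asymptotics.isLittleO_iff.1 ((isLittleO_exp_mul_integral_exp_mul hw hw_int hX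
    hX_unbounded K).const_mul_left (∫ ω, |u ω| ∂ν)) (half_pos hε)
  filter_upwards [hsmall, eventually_ge_atTop 0] with a hsmall_a ha
  have hle := abs_integral_exp_mul_le hw (half_pos hε).le hw_int hu_int
    (fun ω hω => hK _ hω ω rfl) ha
  have hden : 0 ≤ ∫ ω, Real.exp (a * X ω) * w ω ∂ν :=
    integral_nonneg fun ω => (mul_pos (Real.exp_pos _) (hw ω)).le
  have hnum := (le_abs_self _).trans hsmall_a
  rw [Real.norm_eq_abs, abs_of_nonneg hden] at hnum
  rw [Real.norm_eq_abs, Real.norm_eq_abs, abs_of_nonneg hden]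
  linarith

theorem tendsto_integral_exp_mul_div {L : ℝ} (hw : ∀ ω, 0 < w ω)
    (hw_int : ∀ a : ℝ, Integrable (fun ω => Real.exp (a * X ω) * w ω) ν)
    (hu_int : ∀ a : ℝ, Integrable (fun ω => Real.exp (a * X ω) * u ω) ν)
    (hX : Measurable X) (hX_unbounded : ∀ K, ν {ω | K ≤ X ω} ≠ 0)
    (huw : Tendsto (fun ω => u ω / w ω) (comap X atTop) (𝓝 L)) :
    Tendsto (fun a => (∫ ω, Real.exp (a * X ω) * u ω ∂ν) / ∫ ω, Real.exp (a * X ω) * w ω ∂ν)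
      atTop (𝓝 L) := by
  have hsub : (fun ω => u ω - L * w ω) =o[comap X atTop] w := by
    rw [Asymptotics.isLittleO_iff_tendsto fun ω h => absurd h (hw ω).ne']
    simpa only [sub_div, mul_div_cancel_right₀ _ (hw _).ne', sub_self] using huw.sub_const L
  have hu_int₀ : Integrable u ν := by simpa using hu_int 0
  have hw_int₀ : Integrable w ν := by simpa using hw_int 0
  have hsub_int : Integrable (fun ω => u ω - L * w ω) ν := hu_int₀.sub (hw_int₀.const_mul L)
  have hν : ν ≠ 0 := fun h => hX_unbounded 0 (by simp [h])
  have hpos (a : ℝ) : 0 < ∫ ω, Real.exp (a * X ω) * w ω ∂ν :=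
    integral_pos_of_ae_pos hν (hw_int a)
      (Eventually.of_forall fun ω => mul_pos (Real.exp_pos _) (hw ω))
  have hratio :=
    (isLittleO_integral_exp_mul hw hw_int hsub_int hX hX_unbounded hsub).tendsto_div_nhds_zero
  refine tendsto_sub_nhds_zero_iff.1 (hratio.congr fun a => ?_)
  have hsplit : ∫ ω, Real.exp (a * X ω) * (u ω - L * w ω) ∂ν =
      (∫ ω, Real.exp (a * X ω) * u ω ∂ν) - L * ∫ ω, Real.exp (a * X ω) * w ω ∂ν := by
    rw [← integral_const_mul, ← integral_sub (hu_int a) ((hw_int a).const_mul L)]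
    congr with ω
    ring
  rw [hsplit, sub_div, mul_div_cancel_right₀ _ (hpos a).ne']

end Tilting

/-! ### Log-normal mixing -/

section Gaussian

variable {v : NNReal}

lemma gaussianReal_tilted_mul (μ : ℝ) (hv : v ≠ 0) (a : ℝ) :
    (gaussianReal μ v).tilted (fun y => a * y) = gaussianReal (μ + a * v) v := by
  have hmgf : ∫ y, Real.exp (a * y) ∂gaussianReal μ v = Real.exp (μ * a + v * a ^ 2 / 2) :=
    congrFun mgf_id_gaussianReal a
  rw [Measure.tilted, hmgf, gaussianReal_of_var_ne_zero μ hv, gaussianReal_of_var_ne_zero _ hv,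
    ← withDensity_mul _ (measurable_gaussianPDF μ v) (by fun_prop)]
  congr 1 with y
  have hv' : (v : ℝ) ≠ 0 := by exact_mod_cast hv
  rw [Pi.mul_apply, gaussianPDF, gaussianPDF, ← ENNReal.ofReal_mul (gaussianPDFReal_nonneg μ v y),
    gaussianPDFReal_def, gaussianPDFReal_def, mul_assoc, ← Real.exp_sub, ← Real.exp_add]
  congr 3
  field_simp
  ring

lemma integrable_exp_mul_mul_gaussianReal (hv : v ≠ 0) {g : ℝ → ℝ}
    (hg : ∀ μ, Integrable g (gaussianReal μ v)) (a : ℝ) :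
    Integrable (fun y => Real.exp (a * y) * g y) (gaussianReal 0 v) := by
  have htilted := hg (0 + a * v)
  rw [← gaussianReal_tilted_mul 0 hv a] at htilted
  exact (integrable_tilted_iff (integrable_exp_mul_gaussianReal a) g).1 htilted

lemma gaussianReal_Ici_ne_zero (μ : ℝ) (hv : v ≠ 0) (K : ℝ) : gaussianReal μ v (Set.Ici K) ≠ 0 := by
  intro hzero
  simpa using gaussianReal_absolutelyContinuous' μ hv hzero

theorem tendsto_integral_gaussianReal_div (hv : v ≠ 0) {u w : ℝ → ℝ} {L : ℝ} (hw : ∀ y, 0 < w y)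
    (hu_int : ∀ μ, Integrable u (gaussianReal μ v))
    (hw_int : ∀ μ, Integrable w (gaussianReal μ v))
    (huw : Tendsto (fun y => u y / w y) atTop (𝓝 L)) :
    Tendsto (fun μ => (∫ y, u y ∂gaussianReal μ v) / ∫ y, w y ∂gaussianReal μ v)
      atTop (𝓝 L) := by
  have hv' : (0 : ℝ) < v := by exact_mod_cast pos_iff_ne_zero.2 hv
  have htilt := tendsto_integral_exp_mul_div (X := id) hw
    (integrable_exp_mul_mul_gaussianReal hv hw_int) (integrable_exp_mul_mul_gaussianReal hv hu_int)
    measurable_id (gaussianReal_Ici_ne_zero 0 hv) (by simpa only [comap_id] using huw)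
  refine (htilt.comp (tendsto_id.atTop_div_const hv')).congr fun μ => ?_
  have hμ : gaussianReal μ v = (gaussianReal 0 v).tilted (fun y => μ / v * y) := by
    rw [gaussianReal_tilted_mul 0 hv, zero_add, div_mul_cancel₀ _ hv'.ne']
  have hintegral (g : ℝ → ℝ) : ∫ y, g y ∂gaussianReal μ v =
      (∫ y, Real.exp (μ / v * y) * g y ∂gaussianReal 0 v) /
        ∫ y, Real.exp (μ / v * y) ∂gaussianReal 0 v := by
    rw [hμ, integral_tilted, ← integral_div]
    congr with y
    rw [smul_eq_mul, div_mul_eq_mul_div]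
  have hmgf : 0 < ∫ y, Real.exp (μ / v * y) ∂gaussianReal 0 v :=
    integral_exp_pos (integrable_exp_mul_gaussianReal _)
  rw [hintegral, hintegral, div_div_div_cancel_right₀ hmgf.ne']
  rfl

lemma hasDerivAt_gaussianPDFReal (μ : ℝ) (v : NNReal) (y : ℝ) :
    HasDerivAt (gaussianPDFReal μ v) (-((y - μ) / v) * gaussianPDFReal μ v y) y := by
  rw [gaussianPDFReal_def]
  refine (((((hasDerivAt_id' y).sub_const μ).pow 2).neg.div_const (2 * v)).exp.const_mul
    _).congr_deriv ?_
  simp only [Pi.neg_apply, Pi.pow_apply]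
  ring

lemma integrable_gaussianReal_iff (μ : ℝ) (hv : v ≠ 0) {g : ℝ → ℝ} :
    Integrable g (gaussianReal μ v) ↔ Integrable fun y => gaussianPDFReal μ v y * g y := by
  rw [gaussianReal_of_var_ne_zero μ hv, integrable_withDensity_iff_integrable_smul'
    (measurable_gaussianPDF μ v) (Eventually.of_forall fun _ => gaussianPDF_lt_top)]
  simp only [toReal_gaussianPDF, smul_eq_mul]

theorem integral_sub_mul_gaussianReal (μ : ℝ) (hv : v ≠ 0) {g g' : ℝ → ℝ}
    (hderiv : ∀ y, HasDerivAt g (g' y) y) (hg : Integrable g (gaussianReal μ v))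
    (hyg : Integrable (fun y => (y - μ) * g y) (gaussianReal μ v))
    (hg' : Integrable g' (gaussianReal μ v)) :
    ∫ y, (y - μ) * g y ∂gaussianReal μ v = v * ∫ y, g' y ∂gaussianReal μ v := by
  have hv' : (v : ℝ) ≠ 0 := by exact_mod_cast hv
  have hsub : Integrable (fun y => g' y - (y - μ) * g y / v) (gaussianReal μ v) :=
    hg'.sub (hyg.div_const v)
  have hzero : ∫ y, g' y - (y - μ) * g y / v ∂gaussianReal μ v = 0 := by
    rw [integral_gaussianReal_eq_integral_smul hv]
    refine integral_eq_zero_of_hasDerivAt_of_integrable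
      (f := fun y => gaussianPDFReal μ v y * g y) (fun y => ?_)
      ((integrable_gaussianReal_iff μ hv).1 hsub) ((integrable_gaussianReal_iff μ hv).1 hg)
    refine ((hasDerivAt_gaussianPDFReal μ v y).mul (hderiv y)).congr_deriv ?_
    rw [smul_eq_mul]
    ring
  rw [integral_sub hg' (hyg.div_const v), integral_div, sub_eq_zero, eq_div_iff hv'] at hzero
  rw [← hzero, mul_comm]

end Gaussian

section LogNormal

variable {μ σ : ℝ}

lemma logNormal_eq_map (μ σ : ℝ) :
    logNormal μ σ = (gaussianReal μ (Real.toNNReal (σ ^ 2))).map Real.exp := by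
  rw [Real.toNNReal_of_nonneg (sq_nonneg σ)]
  rfl

lemma isMixing_logNormal (μ σ : ℝ) : IsMixing (logNormal μ σ) := by
  rw [logNormal_eq_map]
  have hprob : IsProbabilityMeasure ((gaussianReal μ (Real.toNNReal (σ ^ 2))).map Real.exp) :=
    Measure.isProbabilityMeasure_map Real.measurable_exp.aemeasurable
  refine isMixing_of_isFiniteMeasure ?_ hprob.ne_zero
  rw [ae_map_iff Real.measurable_exp.aemeasurable measurableSet_Ioi]
  exact Eventually.of_forall Real.exp_pos

lemma logNormal_map_mul (μ σ : ℝ) {x : ℝ} (hx : 0 < x) :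
    (logNormal μ σ).map (x * ·) = logNormal (μ + Real.log x) σ := by
  have hcomp : (fun α => x * α) ∘ Real.exp = Real.exp ∘ fun y => y + Real.log x := by
    ext y
    simp only [Function.comp_apply, Real.exp_add, Real.exp_log hx, mul_comm x]
  rw [logNormal_eq_map, Measure.map_map (by fun_prop) (by fun_prop), hcomp,
    ← Measure.map_map (by fun_prop) (by fun_prop), gaussianReal_map_add_const, ← logNormal_eq_map]

lemma integral_logNormal (μ σ : ℝ) (g : ℝ → ℝ) :
    ∫ α, g α ∂logNormal μ σ = ∫ y, g (Real.exp y) ∂gaussianReal μ (Real.toNNReal (σ ^ 2)) := by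
  rw [logNormal_eq_map]
  exact Real.isOpenEmbedding_exp.measurableEmbedding.integral_map _

lemma integrable_logNormal_iff {g : ℝ → ℝ} : Integrable g (logNormal μ σ) ↔
    Integrable (fun y => g (Real.exp y)) (gaussianReal μ (Real.toNNReal (σ ^ 2))) := by
  rw [logNormal_eq_map]
  exact Real.isOpenEmbedding_exp.measurableEmbedding.integrable_map_iff

lemma memLp_log_logNormal (μ σ : ℝ) : MemLp Real.log 2 (logNormal μ σ) := by
  rw [logNormal_eq_map, Real.isOpenEmbedding_exp.measurableEmbedding.memLp_map_measure_iff]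
  have hid : Real.log ∘ Real.exp = id := funext Real.log_exp
  rw [hid]
  exact memLp_id_gaussianReal' 2 (by simp)

theorem tendsto_integral_logNormal_div (hσ : σ ≠ 0) {u w : ℝ → ℝ} {L : ℝ}
    (hw : ∀ α, 0 < α → 0 < w α) (hu_int : ∀ μ, Integrable u (logNormal μ σ))
    (hw_int : ∀ μ, Integrable w (logNormal μ σ))
    (huw : Tendsto (fun α => u α / w α) atTop (𝓝 L)) :
    Tendsto (fun μ => (∫ α, u α ∂logNormal μ σ) / ∫ α, w α ∂logNormal μ σ) atTop (𝓝 L) := by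
  simp only [integral_logNormal]
  have hσ' : Real.toNNReal (σ ^ 2) ≠ 0 := (Real.toNNReal_pos.2 (by positivity)).ne'
  exact tendsto_integral_gaussianReal_div hσ' (fun y => hw _ (Real.exp_pos y))
    (fun μ => integrable_logNormal_iff.1 (hu_int μ))
    (fun μ => integrable_logNormal_iff.1 (hw_int μ)) (huw.comp Real.tendsto_exp_atTop)

theorem integral_log_sub_mul_logNormal (hσ : σ ≠ 0) {g g' : ℝ → ℝ}
    (hderiv : ∀ α, 0 < α → HasDerivAt g (g' α) α) (hg : Integrable g (logNormal μ σ))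
    (hlog : Integrable (fun α => (Real.log α - μ) * g α) (logNormal μ σ))
    (hg' : Integrable (fun α => α * g' α) (logNormal μ σ)) :
    ∫ α, (Real.log α - μ) * g α ∂logNormal μ σ = σ ^ 2 * ∫ α, α * g' α ∂logNormal μ σ := by
  have hσ' : Real.toNNReal (σ ^ 2) ≠ 0 := (Real.toNNReal_pos.2 (by positivity)).ne'
  rw [integrable_logNormal_iff] at hg hlog hg'
  simp only [integral_logNormal, Real.log_exp] at hlog ⊢
  have hexp (y : ℝ) : HasDerivAt (fun y => g (Real.exp y)) (Real.exp y * g' (Real.exp y)) y :=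
    ((hderiv _ (Real.exp_pos y)).comp y (Real.hasDerivAt_exp y)).congr_deriv (mul_comm _ _)
  have hstein := integral_sub_mul_gaussianReal μ hσ' hexp hg hlog hg'
  rwa [Real.coe_toNNReal _ (sq_nonneg σ)] at hstein

end LogNormal

section ShareMoment

variable {F : Measure ℝ} {p : Fin J → ℝ}

lemma hasDerivAt_share_coeff (δ : Fin J → ℝ) (j : Fin J) (p : Fin J → ℝ) (α : ℝ) :
    HasDerivAt (fun α => share δ j α p)
      (share δ j α p * (∑ l, p l * share δ l α p - p j)) α := by
  have hexp (l : Fin J) : HasDerivAt (fun α => Real.exp (δ l - α * p l))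
      (-(p l * Real.exp (δ l - α * p l))) α := by
    convert (((hasDerivAt_id' α).mul_const (p l)).const_sub (δ l)).exp using 1
    ring
  have hdenom := (HasDerivAt.fun_sum (u := Finset.univ) fun l _ => hexp l).const_add 1
  have hpos := logit_denom_pos δ α p
  refine ((hexp j).div hdenom hpos.ne').congr_deriv ?_
  simp only [share, ← mul_div_assoc, ← Finset.sum_div, Finset.sum_neg_distrib]
  field_simp
  ring

lemma abs_sum_mul_share_sub_le (δ : Fin J → ℝ) (j : Fin J) (hp : p ∈ PosPrices J) (α : ℝ) :
    |∑ l, p l * share δ l α p - p j| ≤ ∑ l, p l :=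
  abs_sub_le_of_nonneg_of_le
    (Finset.sum_nonneg fun l _ => mul_nonneg (hp l).le (share_pos δ l α p).le)
    (Finset.sum_le_sum fun l _ => mul_le_of_le_one_right (hp l).le (share_lt_one δ l α p).le)
    (hp j).le (Finset.single_le_sum (fun l _ => (hp l).le) (Finset.mem_univ j))

lemma tendsto_sum_mul_share_sub (δ : Fin J → ℝ) (j : Fin J) (hp : p ∈ PosPrices J) :
    Tendsto (fun α => ∑ l, p l * share δ l α p - p j) atTop (𝓝 (-p j)) := by
  have hsum := tendsto_finsetSum Finset.univ fun l _ =>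
    (tendsto_share_atTop δ l hp).const_mul (p l)
  simpa using hsum.sub_const (p j)

/-- The moment `∫ α ^ m * share δ j α p dF(α)` of the choice probability. After division by a
moment of the right order, demand and its derivatives converge as the mixing law escapes to
infinity. -/
noncomputable def shareMoment (δ : Fin J → ℝ) (F : Measure ℝ) (j : Fin J) (p : Fin J → ℝ)
    (m : ℕ) : ℝ :=
  ∫ α, α ^ m * share δ j α p ∂F

lemma pow_mul_share_pos (δ : Fin J → ℝ) (j : Fin J) (p : Fin J → ℝ) (m : ℕ) {α : ℝ}
    (hα : 0 < α) : 0 < α ^ m * share δ j α p :=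
  mul_pos (pow_pos hα m) (share_pos δ j α p)

lemma IsMixing.shareMoment_pos (hF : IsMixing F) (δ : Fin J → ℝ) (j : Fin J)
    (hp : p ∈ PosPrices J) (m : ℕ) : 0 < shareMoment δ F j p m :=
  hF.integral_pos (hF.integrable_pow_mul_share δ j hp m) fun _ => pow_mul_share_pos δ j p m

lemma IsMixing.memLp_two_pow_mul_share (hF : IsMixing F) (δ : Fin J → ℝ) (j : Fin J)
    (hp : p ∈ PosPrices J) (m : ℕ) : MemLp (fun α => α ^ m * share δ j α p) 2 F := by
  have hcont := continuous_share δ j p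
  rw [memLp_two_iff_integrable_sq (by fun_prop)]
  refine (hF.integrable_pow_mul_share δ j hp (m * 2)).mono' (by fun_prop)
    (Eventually.of_forall fun α => ?_)
  have hpos := share_pos δ j α p
  rw [Real.norm_eq_abs, abs_of_nonneg (sq_nonneg _), mul_pow, pow_mul]
  gcongr
  exact pow_le_of_le_one hpos.le (share_lt_one δ j α p).le two_ne_zero

lemma IsMixing.integrable_shareDeriv₂ (hF : IsMixing F) (δ : Fin J → ℝ) (j k : Fin J)
    (hp : p ∈ PosPrices J) : Integrable (fun α => shareDeriv₂ δ j k α p) F :=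
  ((hF.integrable_pow_mul_share δ j hp 2).const_mul 2).mono'
    (continuous_shareDeriv₂ δ j k p).aestronglyMeasurable
    (Eventually.of_forall fun α => abs_shareDeriv₂_le δ j k α p)

/-- The derivative of `α ^ m * share δ j α p` with respect to `log α`. -/
noncomputable def powShareDeriv (δ : Fin J → ℝ) (j : Fin J) (p : Fin J → ℝ) (m : ℕ) (α : ℝ) : ℝ :=
  m * (α ^ m * share δ j α p) +
    α ^ (m + 1) * share δ j α p * (∑ l, p l * share δ l α p - p j)

lemma hasDerivAt_pow_mul_share (δ : Fin J → ℝ) (j : Fin J) (p : Fin J → ℝ) (m : ℕ) {α : ℝ}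
    (hα : α ≠ 0) :
    HasDerivAt (fun α => α ^ m * share δ j α p) (powShareDeriv δ j p m α / α) α := by
  refine ((hasDerivAt_pow m α).mul (hasDerivAt_share_coeff δ j p α)).congr_deriv ?_
  rw [powShareDeriv, eq_div_iff hα]
  cases m with
  | zero => simp only [Nat.cast_zero, pow_zero]; ring
  | succ m => simp only [Nat.add_sub_cancel]; ring

lemma IsMixing.integrable_powShareDeriv (hF : IsMixing F) (δ : Fin J → ℝ) (j : Fin J)
    (hp : p ∈ PosPrices J) (m : ℕ) : Integrable (powShareDeriv δ j p m) F := by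
  have hcont (l : Fin J) := continuous_share δ l p
  exact ((hF.integrable_pow_mul_share δ j hp m).const_mul m).add
    ((hF.integrable_pow_mul_share δ j hp (m + 1)).mul_bdd (by fun_prop)
      (Eventually.of_forall fun α => abs_sum_mul_share_sub_le δ j hp α))

end ShareMoment

section LogNormalLimit

variable {μ σ : ℝ} {p : Fin J → ℝ}

lemma integrable_log_mul_pow_mul_share (μ σ : ℝ) (δ : Fin J → ℝ) (j : Fin J)
    (hp : p ∈ PosPrices J) (m : ℕ) :
    Integrable (fun α => Real.log α * (α ^ m * share δ j α p)) (logNormal μ σ) :=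
  (memLp_log_logNormal μ σ).integrable_mul
    ((isMixing_logNormal μ σ).memLp_two_pow_mul_share δ j hp m)

theorem mul_shareMoment_logNormal (hσ : σ ≠ 0) (μ : ℝ) (δ : Fin J → ℝ) (j : Fin J)
    (hp : p ∈ PosPrices J) (m : ℕ) :
    μ * shareMoment δ (logNormal μ σ) j p m =
      ∫ α, Real.log α * (α ^ m * share δ j α p) - σ ^ 2 * powShareDeriv δ j p m α
        ∂logNormal μ σ := by
  have hF := isMixing_logNormal μ σ
  have hg := hF.integrable_pow_mul_share δ j hp m
  have hlog := integrable_log_mul_pow_mul_share μ σ δ j hp m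
  have hlog_sub : Integrable (fun α => (Real.log α - μ) * (α ^ m * share δ j α p))
      (logNormal μ σ) := by
    simp only [sub_mul]
    exact hlog.sub (hg.const_mul μ)
  have hderiv := hF.integrable_powShareDeriv δ j hp m
  have hcancel : (fun α => α * (powShareDeriv δ j p m α / α)) =ᵐ[logNormal μ σ]
      powShareDeriv δ j p m := hF.pos.mono fun α hα => mul_div_cancel₀ _ hα.ne'
  have hstein := integral_log_sub_mul_logNormal hσ
    (fun α hα => hasDerivAt_pow_mul_share δ j p m hα.ne') hg hlog_sub (hderiv.congr hcancel.symm)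
  simp only [sub_mul] at hstein
  rw [integral_congr_ae hcancel, integral_sub hlog (hg.const_mul μ), integral_const_mul] at hstein
  rw [integral_sub hlog (hderiv.const_mul _), integral_const_mul, ← hstein, sub_sub_cancel,
    shareMoment]

lemma tendsto_log_sub_powShareDeriv_div (σ : ℝ) (δ : Fin J → ℝ) (j : Fin J)
    (hp : p ∈ PosPrices J) (m : ℕ) :
    Tendsto (fun α => (Real.log α * (α ^ m * share δ j α p) - σ ^ 2 * powShareDeriv δ j p m α) /
      (α ^ (m + 1) * share δ j α p)) atTop (𝓝 (σ ^ 2 * p j)) := by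
  have hlog : Tendsto (fun α => Real.log α / α) atTop (𝓝 0) :=
    Real.isLittleO_log_id_atTop.tendsto_div_nhds_zero
  have hm : Tendsto (fun α : ℝ => m / α) atTop (𝓝 0) := tendsto_const_nhds.div_atTop tendsto_id
  have hlim := hlog.sub ((hm.add (tendsto_sum_mul_share_sub δ j hp)).const_mul (σ ^ 2))
  rw [zero_add, zero_sub, mul_neg, neg_neg] at hlim
  refine hlim.congr' ((eventually_gt_atTop 0).mono fun α hα => ?_)
  have hshare := (share_pos δ j α p).ne'
  simp only [powShareDeriv]
  field_simp
  ring

theorem tendsto_mul_shareMoment_div (hσ : σ ≠ 0) (δ : Fin J → ℝ) (j : Fin J)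
    (hp : p ∈ PosPrices J) (m : ℕ) :
    Tendsto (fun μ => μ * shareMoment δ (logNormal μ σ) j p m /
      shareMoment δ (logNormal μ σ) j p (m + 1)) atTop (𝓝 (σ ^ 2 * p j)) := by
  simp only [mul_shareMoment_logNormal hσ _ δ j hp]
  exact tendsto_integral_logNormal_div hσ (fun _ => pow_mul_share_pos δ j p (m + 1))
    (fun μ => (integrable_log_mul_pow_mul_share μ σ δ j hp m).sub
      (((isMixing_logNormal μ σ).integrable_powShareDeriv δ j hp m).const_mul _))
    (fun μ => (isMixing_logNormal μ σ).integrable_pow_mul_share δ j hp (m + 1))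
    (tendsto_log_sub_powShareDeriv_div σ δ j hp m)

/-- The factors `μ` and `σ ^ 2 * p j` of `tendsto_mul_shareMoment_div` cancel in this ratio. -/
theorem tendsto_shareMoment_zero_mul_two_div_sq (hσ : σ ≠ 0) (δ : Fin J → ℝ) (j : Fin J)
    (hp : p ∈ PosPrices J) :
    Tendsto (fun μ => shareMoment δ (logNormal μ σ) j p 0 * shareMoment δ (logNormal μ σ) j p 2 /
      shareMoment δ (logNormal μ σ) j p 1 ^ 2) atTop (𝓝 1) := by
  have hlim : σ ^ 2 * p j ≠ 0 := mul_ne_zero (pow_ne_zero 2 hσ) (hp j).ne'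
  have hratio := (tendsto_mul_shareMoment_div hσ δ j hp 0).div
    (tendsto_mul_shareMoment_div hσ δ j hp 1) hlim
  rw [div_self hlim] at hratio
  refine hratio.congr' ((eventually_ne_atTop 0).mono fun μ hμ => ?_)
  have hpos (m : ℕ) := ((isMixing_logNormal μ σ).shareMoment_pos δ j hp m).ne'
  have h1 := hpos 1
  have h2 := hpos 2
  simp only [Pi.div_apply]
  field_simp

lemma tendsto_integral_shareDeriv_div_shareMoment (hσ : σ ≠ 0) (δ : Fin J → ℝ) (j k : Fin J)
    (hp : p ∈ PosPrices J) :
    Tendsto (fun μ => (∫ α, shareDeriv δ j k α p ∂logNormal μ σ) /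
      shareMoment δ (logNormal μ σ) j p 1) atTop (𝓝 (-if k = j then 1 else 0)) := by
  refine tendsto_integral_logNormal_div hσ (fun _ => pow_mul_share_pos δ j p 1)
    (fun μ => (isMixing_logNormal μ σ).integrable_shareDeriv δ j k hp)
    (fun μ => (isMixing_logNormal μ σ).integrable_pow_mul_share δ j hp 1) ?_
  have hlim := (tendsto_share_atTop δ k hp).sub_const (if k = j then (1 : ℝ) else 0)
  rw [zero_sub] at hlim
  refine hlim.congr' ((eventually_gt_atTop 0).mono fun α hα => ?_)
  have hshare := (share_pos δ j α p).ne'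
  simp only [shareDeriv]
  field_simp

lemma tendsto_integral_shareDeriv₂_div_shareMoment (hσ : σ ≠ 0) (δ : Fin J → ℝ) (j k : Fin J)
    (hp : p ∈ PosPrices J) :
    Tendsto (fun μ => (∫ α, shareDeriv₂ δ j k α p ∂logNormal μ σ) /
      shareMoment δ (logNormal μ σ) j p 2) atTop (𝓝 (if k = j then 1 else 0)) := by
  refine tendsto_integral_logNormal_div hσ (fun _ => pow_mul_share_pos δ j p 2)
    (fun μ => (isMixing_logNormal μ σ).integrable_shareDeriv₂ δ j k hp)
    (fun μ => (isMixing_logNormal μ σ).integrable_pow_mul_share δ j hp 2) ?_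
  have hj := tendsto_share_atTop δ j hp
  have hk := tendsto_share_atTop δ k hp
  have hlim := ((hj.sub_const 1).mul (hk.sub_const (if k = j then (1 : ℝ) else 0))).add
    (hk.mul (hj.sub_const (if k = j then (1 : ℝ) else 0)))
  rw [zero_sub, zero_sub, neg_mul_neg, one_mul, zero_mul, add_zero] at hlim
  refine hlim.congr' ((eventually_gt_atTop 0).mono fun α hα => ?_)
  have hshare := (share_pos δ j α p).ne'
  simp only [shareDeriv₂]
  field_simp

theorem tendsto_offDiagTerm_demand_logNormal_mean {M : ℝ} (hM : M ≠ 0) (hσ : σ ≠ 0)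
    (δ : Fin J → ℝ) (j k : Fin J) (hp : p ∈ PosPrices J) :
    Tendsto (fun μ => offDiagTerm (demand M δ (logNormal μ σ)) j k p) atTop (𝓝 0) := by
  have hDk := tendsto_integral_shareDeriv_div_shareMoment hσ δ j k hp
  have hDj := tendsto_integral_shareDeriv_div_shareMoment hσ δ j j hp
  have hlim := (((tendsto_shareMoment_zero_mul_two_div_sq hσ δ j hp).mul
    (tendsto_integral_shareDeriv₂_div_shareMoment hσ δ j k hp)).sub (hDk.mul hDj)).div
      (hDj.pow 2) (by simp)
  simp only [if_true, one_mul, mul_neg, mul_one, neg_neg, sub_self, zero_div] at hlim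
  refine hlim.congr fun μ => ?_
  have hF := isMixing_logNormal μ σ
  have hT (m : ℕ) := (hF.shareMoment_pos δ j hp m).ne'
  have hT1 := hT 1
  have hT2 := hT 2
  have hself := hF.integral_shareDeriv_ne_zero δ j j hp
  have hT0 : ∫ α, share δ j α p ∂logNormal μ σ = shareMoment δ (logNormal μ σ) j p 0 := by
    simp only [shareMoment, pow_zero, one_mul]
  rw [hF.offDiagTerm_demand hM δ j k hp, hT0]
  simp only [Pi.div_apply]
  field_simp

theorem tendsto_offDiagTerm_logNormal {M : ℝ} (hM : M ≠ 0) (μ : ℝ) (hσ : σ ≠ 0)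
    (δ : Fin J → ℝ) (j k : Fin J) (hp : p ∈ PosPrices J) :
    Tendsto (fun x : ℝ => offDiagTerm (demand M δ (logNormal μ σ)) j k (x • p)) atTop (𝓝 0) := by
  refine ((tendsto_offDiagTerm_demand_logNormal_mean hM hσ δ j k hp).comp
    (tendsto_atTop_add_const_left atTop μ Real.tendsto_log_atTop)).congr' ?_
  filter_upwards [eventually_gt_atTop 0] with x hx
  rw [offDiagTerm_demand_smul M δ _ j k hx.ne', logNormal_map_mul μ σ hx, Function.comp_apply]

theorem tendsto_diagTerm_logNormal {M : ℝ} (hM : M ≠ 0) (μ : ℝ) (hσ : σ ≠ 0) (δ : Fin J → ℝ)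
    (j : Fin J) (hp : p ∈ PosPrices J) :
    Tendsto (fun x : ℝ => diagTerm (demand M δ (logNormal μ σ)) j (x • p)) atTop (𝓝 (-1)) :=
  zero_sub (1 : ℝ) ▸ tendsto_diagTerm_of_tendsto_offDiagTerm
    ((isMixing_logNormal μ σ).regular_demand hM δ) hp
    (tendsto_offDiagTerm_logNormal hM μ hσ δ j j hp)

end LogNormalLimit

/-! ### Gamma mixing -/

/-- The measure `z ^ (r - 1) dz` on the positive half-line, the limit of the gamma laws of shape `r`
as the rate tends to zero, up to normalization. It is infinite, but mixing over it gives `tailH`. -/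
noncomputable def powMeasure (r : ℝ) : Measure ℝ :=
  (volume.restrict (Set.Ioi 0)).withDensity fun z => ENNReal.ofReal (z ^ (r - 1))

section PowMeasure

lemma integral_powMeasure (r : ℝ) (g : ℝ → ℝ) :
    ∫ z, g z ∂powMeasure r = ∫ z in Set.Ioi 0, z ^ (r - 1) * g z := by
  rw [powMeasure, integral_withDensity_eq_integral_toReal_smul (by fun_prop)
    (Eventually.of_forall fun _ => ENNReal.ofReal_lt_top)]
  refine setIntegral_congr_fun measurableSet_Ioi fun z hz => ?_
  rw [ENNReal.toReal_ofReal (Real.rpow_nonneg (le_of_lt hz) _), smul_eq_mul]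

lemma integrable_powMeasure_iff (r : ℝ) (g : ℝ → ℝ) :
    Integrable g (powMeasure r) ↔ IntegrableOn (fun z => z ^ (r - 1) * g z) (Set.Ioi 0) := by
  rw [powMeasure, integrable_withDensity_iff_integrable_smul' (by fun_prop)
    (Eventually.of_forall fun _ => ENNReal.ofReal_lt_top)]
  refine integrableOn_congr_fun (fun z hz => ?_) measurableSet_Ioi
  rw [ENNReal.toReal_ofReal (Real.rpow_nonneg (le_of_lt hz) _), smul_eq_mul]

lemma integral_powMeasure_pow_mul_exp {r : ℝ} (hr : 0 < r) (m : ℕ) {c : ℝ} (hc : 0 < c) :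
    ∫ z, z ^ m * Real.exp (-(c * z)) ∂powMeasure r = Real.Gamma (r + m) / c ^ (r + m) := by
  rw [integral_powMeasure, div_eq_inv_mul, ← Real.inv_rpow hc.le, ← one_div,
    ← Real.integral_rpow_mul_exp_neg_mul_Ioi (by positivity) hc]
  refine setIntegral_congr_fun measurableSet_Ioi fun z hz => ?_
  rw [← mul_assoc, ← Real.rpow_natCast, ← Real.rpow_add hz, sub_add_eq_add_sub]

lemma isMixing_powMeasure {r : ℝ} (hr : 0 < r) : IsMixing (powMeasure r) where
  pos := (withDensity_absolutelyContinuous _ _).ae_le (ae_restrict_mem measurableSet_Ioi)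
  integrable_exp c hc := by
    rw [integrable_powMeasure_iff]
    simpa only [Real.rpow_one, neg_mul] using
      integrableOn_rpow_mul_exp_neg_mul_rpow (by linarith : -1 < r - 1) one_pos hc
  ne_zero h := by
    have hzero := integral_powMeasure_pow_mul_exp hr 0 one_pos
    simp [h, (Real.Gamma_pos_of_pos hr).ne] at hzero

end PowMeasure

section GammaMeasure

variable {r β : ℝ}

lemma isMixing_gammaMeasure (hr : 0 < r) (hβ : 0 < β) : IsMixing (gammaMeasure r β) := by
  have hprob := isProbabilityMeasure_gammaMeasure hr hβ
  refine isMixing_of_isFiniteMeasure ?_ hprob.ne_zero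
  rw [gammaMeasure, ae_withDensity_iff (f := gammaPDF r β)
    (measurable_gammaPDFReal r β).ennreal_ofReal]
  filter_upwards [Measure.ae_ne volume (0 : ℝ)] with α hα hpdf
  by_contra hneg
  exact hpdf (gammaPDF_of_neg (lt_of_le_of_ne (not_lt.1 hneg) hα))

lemma gammaPDF_eq_mul_gammaPDF_mul (hβ : 0 ≤ β) {x : ℝ} (hx : 0 < x) (α : ℝ) :
    gammaPDF r β α = ENNReal.ofReal x * gammaPDF r (β / x) (x * α) := by
  obtain hα | hα := lt_or_ge α 0
  · rw [gammaPDF_of_neg hα, gammaPDF_of_neg (mul_neg_of_pos_of_neg hx hα), mul_zero]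
  · have hexp : β / x * (x * α) = β * α := by field_simp
    rw [gammaPDF_of_nonneg hα, gammaPDF_of_nonneg (mul_nonneg hx.le hα),
      ← ENNReal.ofReal_mul hx.le, Real.mul_rpow hx.le hα, Real.div_rpow hβ hx.le,
      Real.rpow_sub_one hx.ne', hexp]
    have := Real.rpow_pos_of_pos hx r
    congr 1
    field_simp

theorem gammaMeasure_map_mul (hβ : 0 ≤ β) {x : ℝ} (hx : 0 < x) :
    (gammaMeasure r β).map (x * ·) = gammaMeasure r (β / x) := by
  have hpdf : Measurable (gammaPDF r (β / x)) := (measurable_gammaPDFReal r _).ennreal_ofReal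
  have hmul : Measurable (x * ·) := measurable_const_mul x
  refine Measure.ext fun s hs => ?_
  rw [Measure.map_apply hmul hs, gammaMeasure, gammaMeasure, withDensity_apply _ (hmul hs),
    withDensity_apply _ hs]
  conv_rhs =>
    rw [← Real.smul_map_volume_mul_left hx.ne', abs_of_pos hx, setLIntegral_smul_measure,
      setLIntegral_map hs hpdf hmul, smul_eq_mul]
  exact (lintegral_congr fun α => gammaPDF_eq_mul_gammaPDF_mul hβ hx α).trans
    (lintegral_const_mul _ (hpdf.comp hmul))

theorem integral_gammaMeasure (hr : 0 < r) (hβ : 0 < β) (g : ℝ → ℝ) :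
    ∫ α, g α ∂gammaMeasure r β =
      β ^ r / Real.Gamma r * ∫ z, Real.exp (-(β * z)) * g z ∂powMeasure r := by
  rw [gammaMeasure, integral_withDensity_eq_integral_toReal_smul (f := gammaPDF r β)
    (measurable_gammaPDFReal r β).ennreal_ofReal
    (Eventually.of_forall fun _ => ENNReal.ofReal_lt_top),
    ← setIntegral_eq_integral_of_forall_compl_eq_zero (s := Set.Ici 0),
    integral_Ici_eq_integral_Ioi, integral_powMeasure, ← integral_const_mul]
  · refine setIntegral_congr_fun measurableSet_Ioi fun α hα => ?_
    have hα₀ : 0 ≤ α := le_of_lt hα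
    rw [gammaPDF, ENNReal.toReal_ofReal (gammaPDFReal_nonneg hr hβ α), gammaPDFReal, if_pos hα₀,
      smul_eq_mul]
    ring
  · intro α hα
    rw [gammaPDF_of_neg (not_le.1 hα), ENNReal.toReal_zero, zero_smul]

lemma tendsto_integral_exp_neg_mul_mul {F : Measure ℝ} (hF : ∀ᵐ α ∂F, 0 < α) {g : ℝ → ℝ}
    (hg : Integrable g F) :
    Tendsto (fun b : ℝ => ∫ z, Real.exp (-(b * z)) * g z ∂F) (𝓝[>] 0) (𝓝 (∫ z, g z ∂F)) := by
  refine tendsto_integral_filter_of_dominated_convergence (fun z => ‖g z‖)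
    (Eventually.of_forall fun b => ?_) ?_ hg.norm (Eventually.of_forall fun z => ?_)
  · exact (Continuous.aestronglyMeasurable (by fun_prop)).mul hg.aestronglyMeasurable
  · filter_upwards [self_mem_nhdsWithin] with b hb
    filter_upwards [hF] with z hz
    rw [norm_mul, Real.norm_eq_abs, abs_of_pos (Real.exp_pos _)]
    exact mul_le_of_le_one_left (norm_nonneg _)
      (Real.exp_le_one_iff.2 (neg_nonpos.2 (mul_pos hb hz).le))
  · have hcont : Continuous fun b : ℝ => Real.exp (-(b * z)) * g z := by fun_prop
    simpa using (hcont.tendsto 0).mono_left nhdsWithin_le_nhds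

end GammaMeasure

section GammaLimit

variable {r : ℝ} {p : Fin J → ℝ}

lemma tailH_eq_demand (δ : Fin J → ℝ) (r : ℝ) : tailH δ r = demand 1 δ (powMeasure r) := by
  ext j p
  rw [demand, one_mul, integral_powMeasure, tailH]

lemma regular_tailH (δ : Fin J → ℝ) (hr : 0 < r) : Regular (tailH δ r) :=
  tailH_eq_demand δ r ▸ (isMixing_powMeasure hr).regular_demand one_ne_zero δ

lemma tailH_pos (δ : Fin J → ℝ) (hr : 0 < r) (j : Fin J) (hp : p ∈ PosPrices J) :
    0 < tailH δ r j p :=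
  tailH_eq_demand δ r ▸ (isMixing_powMeasure hr).demand_pos one_pos δ j hp

theorem tendsto_offDiagTerm_demand_gammaMeasure_rate {M : ℝ} (hM : M ≠ 0) (δ : Fin J → ℝ)
    (hr : 0 < r) (j k : Fin J) (hp : p ∈ PosPrices J) :
    Tendsto (fun b => offDiagTerm (demand M δ (gammaMeasure r b)) j k p) (𝓝[>] 0)
      (𝓝 (offDiagTerm (tailH δ r) j k p)) := by
  have hF := isMixing_powMeasure hr
  have hlim {g : ℝ → ℝ} := tendsto_integral_exp_neg_mul_mul (g := g) hF.pos
  have hDj := hlim (hF.integrable_shareDeriv δ j j hp)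
  have hDj_ne := hF.integral_shareDeriv_ne_zero δ j j hp
  rw [tailH_eq_demand, hF.offDiagTerm_demand one_ne_zero δ j k hp]
  refine ((((hlim (hF.integrable_share δ j hp)).mul (hlim (hF.integrable_shareDeriv₂ δ j k hp))).sub
    ((hlim (hF.integrable_shareDeriv δ j k hp)).mul hDj)).div (hDj.pow 2)
      (pow_ne_zero 2 hDj_ne)).congr' ?_
  filter_upwards [self_mem_nhdsWithin] with b hb
  have hb₀ : 0 < b := hb
  have hc : b ^ r / Real.Gamma r ≠ 0 := by
    have := Real.Gamma_pos_of_pos hr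
    positivity
  simp only [(isMixing_gammaMeasure hr hb).offDiagTerm_demand hM δ j k hp,
    integral_gammaMeasure hr hb, mul_mul_mul_comm, ← mul_sub, mul_pow, ← sq (b ^ r / _)]
  exact (mul_div_mul_left _ _ (pow_ne_zero 2 hc)).symm

theorem tendsto_offDiagTerm_gammaMeasure {M : ℝ} (hM : M ≠ 0) (δ : Fin J → ℝ) (hr : 0 < r) {β : ℝ}
    (hβ : 0 < β) (j k : Fin J) (hp : p ∈ PosPrices J) :
    Tendsto (fun x : ℝ => offDiagTerm (demand M δ (gammaMeasure r β)) j k (x • p)) atTop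
      (𝓝 (offDiagTerm (tailH δ r) j k p)) := by
  have hrate : Tendsto (fun x : ℝ => β / x) atTop (𝓝[>] 0) :=
    tendsto_nhdsWithin_iff.2 ⟨tendsto_const_nhds.div_atTop tendsto_id,
      (eventually_gt_atTop 0).mono fun _ hx => div_pos hβ hx⟩
  refine ((tendsto_offDiagTerm_demand_gammaMeasure_rate hM δ hr j k hp).comp hrate).congr' ?_
  filter_upwards [eventually_gt_atTop 0] with x hx
  rw [offDiagTerm_demand_smul M δ _ j k hx.ne', gammaMeasure_map_mul hβ.le hx, Function.comp_apply]

end GammaLimit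

/-! ### The market-interaction correction -/

section TailC

variable {r : ℝ} {p : Fin J → ℝ}

lemma kernelC_mul (δ : Fin J → ℝ) (r : ℝ) (j : Fin J) (hp : p ∈ PosPrices J) {z : ℝ} (hz : 0 < z) :
    kernelC δ r j p (p j * z) =
      p j ^ (r - 1) * Real.exp (-δ j) * (z ^ (r - 1) * share δ j z p) := by
  have hratio (l : Fin J) : p l / p j * (p j * z) = z * p l := by
    have hpj := hp j
    field_simp
  have hexp : Real.exp (-(p j * z)) = Real.exp (-δ j) * Real.exp (δ j - z * p j) := by
    rw [← Real.exp_add]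
    congr 1
    ring
  simp only [kernelC, share, hratio, hexp, Real.mul_rpow (hp j).le hz.le]
  ring

lemma integrableOn_rpow_mul_share (δ : Fin J → ℝ) (hr : 0 < r) (j : Fin J) (hp : p ∈ PosPrices J) :
    IntegrableOn (fun z => z ^ (r - 1) * share δ j z p) (Set.Ioi 0) :=
  (integrable_powMeasure_iff r _).1 ((isMixing_powMeasure hr).integrable_share δ j hp)

lemma integrableOn_kernelC (δ : Fin J → ℝ) (hr : 0 < r) (j : Fin J) (hp : p ∈ PosPrices J) :
    IntegrableOn (kernelC δ r j p) (Set.Ioi 0) := by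
  rw [← mul_zero (p j), ← integrableOn_Ioi_comp_mul_left_iff _ _ (hp j)]
  exact IntegrableOn.congr_fun ((integrableOn_rpow_mul_share δ hr j hp).const_mul _)
    (fun z hz => (kernelC_mul δ r j hp hz).symm) measurableSet_Ioi

theorem tailH_eq_mul_tailC (δ : Fin J → ℝ) (hr : 0 < r) (j : Fin J) (hp : p ∈ PosPrices J) :
    tailH δ r j p = Real.exp (δ j) * Real.Gamma r * p j ^ (-r) * tailC δ r j p := by
  have hsubst := integral_comp_mul_left_Ioi (kernelC δ r j p) 0 (hp j)
  rw [mul_zero, smul_eq_mul, eq_inv_mul_iff_mul_eq₀ (hp j).ne',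
    setIntegral_congr_fun measurableSet_Ioi fun z hz => kernelC_mul δ r j hp hz,
    integral_const_mul] at hsubst
  rw [tailC, ← hsubst, tailH, Real.rpow_sub_one (hp j).ne', Real.rpow_neg (hp j).le, Real.exp_neg]
  have := Real.Gamma_pos_of_pos hr
  have := Real.rpow_pos_of_pos (hp j) r
  have hpj := hp j
  field_simp

lemma tailC_pos (δ : Fin J → ℝ) (hr : 0 < r) (j : Fin J) (hp : p ∈ PosPrices J) :
    0 < tailC δ r j p := by
  have hH := tailH_pos δ hr j hp
  have hΓ := Real.Gamma_pos_of_pos hr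
  have hpow := Real.rpow_pos_of_pos (hp j) (-r)
  rw [tailH_eq_mul_tailC δ hr j hp] at hH
  exact pos_of_mul_pos_right hH (by positivity)

lemma logC_eqOn (δ : Fin J → ℝ) (hr : 0 < r) (j : Fin J) :
    Set.EqOn (logC δ r j) (fun p => r * Real.log (p j) + logDemand (tailH δ r) j p -
      Real.log (Real.exp (δ j) * Real.Gamma r)) (PosPrices J) := by
  intro p hp
  have := Real.Gamma_pos_of_pos hr
  have hpow := Real.rpow_pos_of_pos (hp j) (-r)
  simp only [logC, logDemand, tailH_eq_mul_tailC δ hr j hp]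
  rw [Real.log_mul (by positivity) (tailC_pos δ hr j hp).ne', Real.log_mul (by positivity) hpow.ne',
    Real.log_rpow (hp j)]
  ring

lemma hasDerivAt_logC (δ : Fin J → ℝ) (hr : 0 < r) (j k : Fin J) (hp : p ∈ PosPrices J) :
    HasDerivAt (fun t => logC δ r j (Function.update p k t))
      (r * ((Pi.single k 1 : Fin J → ℝ) j / p j) + pderiv k (logDemand (tailH δ r) j) p) (p k) := by
  have hcoord := (hasDerivAt_pi.1 (hasDerivAt_update p k (p k)) j).log
    (by simpa using (hp j).ne')
  rw [Function.update_eq_self] at hcoord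
  have hH := (hasPartialAt_logDemand (regular_tailH δ hr) (fun _ => tailH_pos δ hr j)
    hp k).hasDerivAt
  exact (((hcoord.const_mul r).add hH).sub_const _).congr_of_eventuallyEq
    (eventuallyEq_update_of_eqOn_posPrices (logC_eqOn δ hr j) hp k)

lemma hasPartialAt_logC (δ : Fin J → ℝ) (hr : 0 < r) (j k : Fin J) (hp : p ∈ PosPrices J) :
    HasPartialAt k (logC δ r j) p :=
  (hasDerivAt_logC δ hr j k hp).differentiableAt

lemma pderiv_logC_eqOn (δ : Fin J → ℝ) (hr : 0 < r) (j k : Fin J) :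
    Set.EqOn (pderiv k (logC δ r j)) (fun p => r * ((Pi.single k 1 : Fin J → ℝ) j / p j) +
      pderiv k (logDemand (tailH δ r) j) p) (PosPrices J) :=
  fun _ hp => (hasDerivAt_logC δ hr j k hp).deriv

lemma hasDerivAt_pderiv_logC (δ : Fin J → ℝ) (hr : 0 < r) (j k : Fin J) (hp : p ∈ PosPrices J) :
    HasDerivAt (fun t => pderiv k (logC δ r j) (Function.update p j t))
      (-(r * ((Pi.single k 1 : Fin J → ℝ) j / p j ^ 2)) +
        pderiv j (pderiv k (logDemand (tailH δ r) j)) p) (p j) := by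
  have hinv : HasDerivAt (fun t => r * ((Pi.single k 1 : Fin J → ℝ) j / Function.update p j t j))
      (-(r * ((Pi.single k 1 : Fin J → ℝ) j / p j ^ 2))) (p j) := by
    simp only [Function.update_self, div_eq_mul_inv]
    refine (((hasDerivAt_inv (hp j).ne').const_mul _).const_mul r).congr_deriv ?_
    ring
  have hH := (hasPartialAt_pderiv_logDemand (regular_tailH δ hr) (fun _ => tailH_pos δ hr j)
    hp k).hasDerivAt
  exact (hinv.add hH).congr_of_eventuallyEq
    (eventuallyEq_update_of_eqOn_posPrices (pderiv_logC_eqOn δ hr j k) hp j)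

lemma hasPartialAt_pderiv_logC (δ : Fin J → ℝ) (hr : 0 < r) (j k : Fin J) (hp : p ∈ PosPrices J) :
    HasPartialAt j (pderiv k (logC δ r j)) p :=
  (hasDerivAt_pderiv_logC δ hr j k hp).differentiableAt

lemma one_add_zetaTerm (δ : Fin J → ℝ) (hr : 0 < r) (j : Fin J) (hp : p ∈ PosPrices J) :
    1 + zetaTerm δ r j p = -(p j / r) * pderiv j (logDemand (tailH δ r) j) p := by
  rw [zetaTerm, pderiv_logC_eqOn δ hr j j hp, Pi.single_eq_same]
  have hpj := hp j
  field_simp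
  ring

lemma one_add_chiTerm (δ : Fin J → ℝ) (hr : 0 < r) (j : Fin J) (hp : p ∈ PosPrices J) :
    1 + chiTerm δ r j p = p j ^ 2 / r * pderiv j (pderiv j (logDemand (tailH δ r) j)) p := by
  have hjj : pderiv j (pderiv j (logC δ r j)) p = _ := (hasDerivAt_pderiv_logC δ hr j j hp).deriv
  rw [chiTerm, hjj, Pi.single_eq_same]
  have hpj := hp j
  field_simp
  ring

lemma xiTerm_eq (δ : Fin J → ℝ) (hr : 0 < r) {j k : Fin J} (hkj : k ≠ j) (hp : p ∈ PosPrices J) :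
    xiTerm δ r j k p = p j ^ 2 / r * pderiv j (pderiv k (logDemand (tailH δ r) j)) p := by
  have hjk : pderiv j (pderiv k (logC δ r j)) p = _ := (hasDerivAt_pderiv_logC δ hr j k hp).deriv
  rw [xiTerm, hjk, Pi.single_eq_of_ne hkj.symm, zero_div, mul_zero, neg_zero, zero_add]

lemma pderiv_logDemand_tailH (δ : Fin J → ℝ) (hr : 0 < r) (j k : Fin J) (hp : p ∈ PosPrices J) :
    pderiv k (logDemand (tailH δ r) j) p =
      (∫ z, shareDeriv δ j k z p ∂powMeasure r) / shareMoment δ (powMeasure r) j p 0 := by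
  rw [pderiv_logDemand (regular_tailH δ hr) (fun _ => tailH_pos δ hr j) hp, tailH_eq_demand,
    (isMixing_powMeasure hr).pderiv_demand 1 δ j k hp, demand, shareMoment]
  simp only [one_mul, pow_zero]

lemma pderiv_logDemand_tailH_self_neg (δ : Fin J → ℝ) (hr : 0 < r) (j : Fin J)
    (hp : p ∈ PosPrices J) : pderiv j (logDemand (tailH δ r) j) p < 0 := by
  have hF := isMixing_powMeasure hr
  rw [pderiv_logDemand_tailH δ hr j j hp]
  exact div_neg_of_neg_of_pos (hF.integral_shareDeriv_self_neg δ j hp) (hF.shareMoment_pos δ j hp 0)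

lemma pderiv_logDemand_tailH_pos (δ : Fin J → ℝ) (hr : 0 < r) {j k : Fin J} (hkj : k ≠ j)
    (hp : p ∈ PosPrices J) : 0 < pderiv k (logDemand (tailH δ r) j) p := by
  have hF := isMixing_powMeasure hr
  rw [pderiv_logDemand_tailH δ hr j k hp]
  exact div_pos (hF.integral_shareDeriv_pos δ hkj hp) (hF.shareMoment_pos δ j hp 0)

lemma one_add_zetaTerm_pos (δ : Fin J → ℝ) (hr : 0 < r) (j : Fin J) (hp : p ∈ PosPrices J) :
    0 < 1 + zetaTerm δ r j p := by
  rw [one_add_zetaTerm δ hr j hp]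
  exact mul_pos_of_neg_of_neg (neg_neg_of_pos (div_pos (hp j) hr))
    (pderiv_logDemand_tailH_self_neg δ hr j hp)

theorem gammaDiagLimit_eq (δ : Fin J → ℝ) (hr : 0 < r) (j : Fin J) (hp : p ∈ PosPrices J) :
    gammaDiagLimit δ r j p = offDiagTerm (tailH δ r) j j p - 1 := by
  have hpj := hp j
  have hneg := (pderiv_logDemand_tailH_self_neg δ hr j hp).ne
  rw [gammaDiagLimit, one_add_zetaTerm δ hr j hp, one_add_chiTerm δ hr j hp,
    offDiagTerm_eq_logDemand (regular_tailH δ hr) (fun _ => tailH_pos δ hr j) hp]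
  field_simp
  ring

theorem gammaOffDiagLimit_eq (δ : Fin J → ℝ) (hr : 0 < r) {j k : Fin J} (hkj : k ≠ j)
    (hp : p ∈ PosPrices J) : gammaOffDiagLimit δ r j k p = offDiagTerm (tailH δ r) j k p := by
  have hpj := hp j
  have hneg := (pderiv_logDemand_tailH_self_neg δ hr j hp).ne
  rw [gammaOffDiagLimit, one_add_zetaTerm δ hr j hp, xiTerm_eq δ hr hkj hp,
    offDiagTerm_eq_logDemand (regular_tailH δ hr) (fun _ => tailH_pos δ hr j) hp]
  field_simp

theorem tendsto_offDiagTerm_gamma {M : ℝ} (hM : M ≠ 0) (δ : Fin J → ℝ) (hr : 0 < r) {β : ℝ}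
    (hβ : 0 < β) {j k : Fin J} (hkj : k ≠ j) (hp : p ∈ PosPrices J) :
    Tendsto (fun x : ℝ => offDiagTerm (demand M δ (gammaMeasure r β)) j k (x • p)) atTop
      (𝓝 (gammaOffDiagLimit δ r j k p)) :=
  gammaOffDiagLimit_eq δ hr hkj hp ▸ tendsto_offDiagTerm_gammaMeasure hM δ hr hβ j k hp

theorem tendsto_diagTerm_gamma {M : ℝ} (hM : M ≠ 0) (δ : Fin J → ℝ) (hr : 0 < r) {β : ℝ}
    (hβ : 0 < β) (j : Fin J) (hp : p ∈ PosPrices J) :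
    Tendsto (fun x : ℝ => diagTerm (demand M δ (gammaMeasure r β)) j (x • p)) atTop
      (𝓝 (gammaDiagLimit δ r j p)) :=
  gammaDiagLimit_eq δ hr j hp ▸ tendsto_diagTerm_of_tendsto_offDiagTerm
    ((isMixing_gammaMeasure hr hβ).regular_demand hM δ) hp
    (tendsto_offDiagTerm_gammaMeasure hM δ hr hβ j j hp)

end TailC

section SingleGood

variable {j : Fin J} {p : Fin J → ℝ}

lemma tailC_eq_of_unique (δ : Fin J → ℝ) (r : ℝ) (hj : ∀ k, k = j) {p' : Fin J → ℝ}
    (hp : p ∈ PosPrices J) (hp' : p' ∈ PosPrices J) : tailC δ r j p = tailC δ r j p' := by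
  have hratio (l : Fin J) : p l / p j = p' l / p' j := by
    rw [hj l, div_self (hp j).ne', div_self (hp' j).ne']
  simp only [tailC, kernelC, hratio]

lemma pderiv_logC_eqOn_zero_of_unique (δ : Fin J → ℝ) (r : ℝ) (hj : ∀ k, k = j) :
    Set.EqOn (pderiv j (logC δ r j)) (fun _ => 0) (PosPrices J) := by
  intro p hp
  have hconst : Set.EqOn (logC δ r j) (fun _ => logC δ r j p) (PosPrices J) := fun p' hp' =>
    congrArg Real.log (tailC_eq_of_unique δ r hj hp' hp)
  exact (pderiv_eqOn_posPrices hconst j hp).trans (deriv_const _ _)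

lemma zetaTerm_of_unique (δ : Fin J → ℝ) (r : ℝ) (hj : ∀ k, k = j) (hp : p ∈ PosPrices J) :
    zetaTerm δ r j p = 0 := by
  rw [zetaTerm, pderiv_logC_eqOn_zero_of_unique δ r hj hp, mul_zero]

lemma chiTerm_of_unique (δ : Fin J → ℝ) (r : ℝ) (hj : ∀ k, k = j) (hp : p ∈ PosPrices J) :
    chiTerm δ r j p = 0 := by
  have hzero : pderiv j (pderiv j (logC δ r j)) p = 0 :=
    (pderiv_eqOn_posPrices (pderiv_logC_eqOn_zero_of_unique δ r hj) j hp).trans (deriv_const _ _)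
  rw [chiTerm, hzero, mul_zero]

lemma gammaDiagLimit_of_unique (δ : Fin J → ℝ) (r : ℝ) (hj : ∀ k, k = j) (hp : p ∈ PosPrices J) :
    gammaDiagLimit δ r j p = -1 + 1 / r := by
  rw [gammaDiagLimit, zetaTerm_of_unique δ r hj hp, chiTerm_of_unique δ r hj hp]
  norm_num

end SingleGood

/-! ### Dependence on the ray -/

section HalfLine

variable {f f' : ℝ → ℝ}

lemma exists_deriv_pos_and_neg_of_tendsto_zero (hpos : ∀ t, 0 < t → 0 < f t)
    (hderiv : ∀ t, 0 < t → HasDerivAt f (f' t) t) (hzero : Tendsto f (𝓝[>] 0) (𝓝 0))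
    (htop : Tendsto f atTop (𝓝 0)) : (∃ t, 0 < t ∧ 0 < f' t) ∧ ∃ t, 0 < t ∧ f' t < 0 := by
  have hslope {a b : ℝ} (ha : 0 < a) (hab : a < b) :
      ∃ t, 0 < t ∧ f' t = (f b - f a) / (b - a) := by
    have hab_deriv : ∀ t ∈ Set.Icc a b, HasDerivAt f (f' t) t := fun t ht =>
      hderiv t (ha.trans_le ht.1)
    obtain ⟨t, ht, heq⟩ := exists_hasDerivAt_eq_slope f f' hab
      (HasDerivAt.continuousOn hab_deriv) fun t ht => hab_deriv t (Set.Ioo_subset_Icc_self ht)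
    exact ⟨t, ha.trans ht.1, heq⟩
  constructor
  · obtain ⟨s, hs, hs₀, hs₁⟩ := ((hzero.eventually_lt_const (hpos 1 one_pos)).and
      (Ioo_mem_nhdsGT one_pos)).exists
    obtain ⟨t, ht, heq⟩ := hslope hs₀ hs₁
    exact ⟨t, ht, heq ▸ div_pos (sub_pos.2 hs) (sub_pos.2 hs₁)⟩
  · obtain ⟨s, hs, hs₁⟩ := ((htop.eventually_lt_const (hpos 1 one_pos)).and
      (eventually_gt_atTop 1)).exists
    obtain ⟨t, ht, heq⟩ := hslope one_pos hs₁
    exact ⟨t, ht, heq ▸ div_neg_of_neg_of_pos (sub_neg.2 hs) (sub_pos.2 hs₁)⟩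

lemma eq_of_hasDerivAt_zero_Ioi (h : ∀ t, 0 < t → HasDerivAt f 0 t) {s t : ℝ} (hs : 0 < s)
    (ht : 0 < t) : f s = f t :=
  isOpen_Ioi.is_const_of_deriv_eq_zero isPreconnected_Ioi
    (fun x hx => (h x hx).differentiableAt.differentiableWithinAt) (fun x hx => (h x hx).deriv)
    hs ht

/-- The solutions of `f' = c * f ^ 2` are the functions `-1 / (c * t + a)`. -/
lemma inv_eq_neg_mul_of_hasDerivAt_mul_sq {c : ℝ} (hne : ∀ t, 0 < t → f t ≠ 0)
    (hderiv : ∀ t, 0 < t → HasDerivAt f (c * f t ^ 2) t)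
    (hzero : Tendsto (fun t => (f t)⁻¹) (𝓝[>] 0) (𝓝 0)) {t : ℝ} (ht : 0 < t) :
    (f t)⁻¹ = -(c * t) := by
  have hconst (s : ℝ) (hs : 0 < s) : HasDerivAt (fun s => (f s)⁻¹ + c * s) 0 s := by
    refine (((hderiv s hs).inv (hne s hs)).add ((hasDerivAt_id s).const_mul c)).congr_deriv ?_
    rw [neg_div, mul_div_cancel_right₀ _ (pow_ne_zero 2 (hne s hs)), mul_one, neg_add_cancel]
  have hlinear : Tendsto (fun s : ℝ => c * s) (𝓝[>] 0) (𝓝 0) := by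
    simpa using ((continuous_const_mul c).tendsto 0).mono_left nhdsWithin_le_nhds
  have hlim := hzero.add hlinear
  rw [add_zero] at hlim
  have heq : Tendsto (fun s => (f s)⁻¹ + c * s) (𝓝[>] 0) (𝓝 ((f t)⁻¹ + c * t)) :=
    tendsto_const_nhds.congr' (eventually_mem_nhdsWithin.mono fun s hs =>
      eq_of_hasDerivAt_zero_Ioi hconst ht hs)
  exact eq_neg_of_add_eq_zero_left (tendsto_nhds_unique heq hlim)

lemma eq_of_hasDerivAt_div_of_le {κ K : ℝ} (hderiv : ∀ t, 0 < t → HasDerivAt f (κ / t) t)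
    (hle : ∀ t, 0 < t → f t ≤ K) {s t : ℝ} (hs : 0 < s) (ht : 0 < t) : f s = f t := by
  have hconst (x : ℝ) (hx : 0 < x) : HasDerivAt (fun x => f x - κ * Real.log x) 0 x :=
    ((hderiv x hx).sub ((Real.hasDerivAt_log hx.ne').const_mul κ)).congr_deriv
      (by rw [div_eq_mul_inv, sub_self])
  have hlog (x : ℝ) (hx : 0 < x) : f x = κ * Real.log x + f 1 := by
    have h := eq_of_hasDerivAt_zero_Ioi hconst hx one_pos
    rw [Real.log_one] at h
    linarith
  have hκ : κ = 0 := by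
    by_contra hκ
    have hx := hle _ (Real.exp_pos ((K - f 1 + 1) / κ))
    rw [hlog _ (Real.exp_pos _), Real.log_exp, mul_div_cancel₀ _ hκ] at hx
    linarith
  rw [hlog s hs, hlog t ht, hκ, zero_mul, zero_mul]

end HalfLine

section Bounds

variable {r : ℝ} {p : Fin J → ℝ}

/-- The denominator of the choice probabilities at zero prices, the largest value that it takes on
the nonnegative orthant. -/
noncomputable def logitDenomZero (δ : Fin J → ℝ) : ℝ := 1 + ∑ l, Real.exp (δ l)

lemma logitDenomZero_pos (δ : Fin J → ℝ) : 0 < logitDenomZero δ := by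
  rw [logitDenomZero]
  positivity

lemma logit_denom_le (δ : Fin J → ℝ) {α : ℝ} (hα : 0 < α) (hp : p ∈ PosPrices J) :
    1 + ∑ l, Real.exp (δ l - α * p l) ≤ logitDenomZero δ := by
  rw [logitDenomZero]
  gcongr with l
  exact sub_le_self _ (mul_pos hα (hp l)).le

lemma exp_div_le_share (δ : Fin J → ℝ) (j : Fin J) {α : ℝ} (hα : 0 < α) (hp : p ∈ PosPrices J) :
    Real.exp (δ j) / logitDenomZero δ * Real.exp (-(p j * α)) ≤ share δ j α p := by
  rw [div_mul_eq_mul_div, ← Real.exp_add, ← sub_eq_add_neg, mul_comm (p j)]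
  exact div_le_div_of_nonneg_left (Real.exp_pos _).le (logit_denom_pos δ α p)
    (logit_denom_le δ hα hp)

lemma inv_le_one_sub_share (δ : Fin J → ℝ) (j : Fin J) {α : ℝ} (hα : 0 < α)
    (hp : p ∈ PosPrices J) : (logitDenomZero δ)⁻¹ ≤ 1 - share δ j α p := by
  have hdenom := logit_denom_pos δ α p
  have hj := Finset.single_le_sum (f := fun l => Real.exp (δ l - α * p l))
    (fun _ _ => (Real.exp_pos _).le) (Finset.mem_univ j)
  calc (logitDenomZero δ)⁻¹ ≤ 1 / (1 + ∑ l, Real.exp (δ l - α * p l)) :=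
        (inv_anti₀ hdenom (logit_denom_le δ hα hp)).trans_eq (one_div _).symm
    _ ≤ (1 + ∑ l, Real.exp (δ l - α * p l) - Real.exp (δ j - α * p j)) /
          (1 + ∑ l, Real.exp (δ l - α * p l)) := by
        gcongr
        linarith
    _ = 1 - share δ j α p := by rw [sub_div, div_self hdenom.ne', share]

lemma shareMoment_powMeasure_le (δ : Fin J → ℝ) (hr : 0 < r) (j : Fin J) (hp : p ∈ PosPrices J)
    (m : ℕ) : shareMoment δ (powMeasure r) j p m ≤
      Real.exp (δ j) * (Real.Gamma (r + m) / p j ^ (r + m)) := by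
  have hF := isMixing_powMeasure hr
  rw [← integral_powMeasure_pow_mul_exp hr m (hp j), ← integral_const_mul]
  refine integral_mono_ae (hF.integrable_pow_mul_share δ j hp m)
    ((hF.integrable_pow_mul_exp m (hp j)).const_mul _) (hF.pos.mono fun z hz => ?_)
  have := pow_pos hz m
  beta_reduce
  rw [mul_left_comm]
  gcongr
  exact share_le_exp δ j z p

lemma le_shareMoment_powMeasure (δ : Fin J → ℝ) (hr : 0 < r) (j : Fin J) (hp : p ∈ PosPrices J)
    (m : ℕ) : Real.exp (δ j) / logitDenomZero δ * (Real.Gamma (r + m) / p j ^ (r + m)) ≤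
      shareMoment δ (powMeasure r) j p m := by
  have hF := isMixing_powMeasure hr
  rw [← integral_powMeasure_pow_mul_exp hr m (hp j), ← integral_const_mul]
  refine integral_mono_ae ((hF.integrable_pow_mul_exp m (hp j)).const_mul _)
    (hF.integrable_pow_mul_share δ j hp m) (hF.pos.mono fun z hz => ?_)
  have := pow_pos hz m
  beta_reduce
  rw [mul_left_comm]
  gcongr
  exact exp_div_le_share δ j hz hp

lemma gamma_succ_div_rpow_succ (hr : 0 < r) {x : ℝ} (hx : 0 < x) :
    Real.Gamma (r + 1) / x ^ (r + 1) = r / x * (Real.Gamma r / x ^ r) := by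
  rw [Real.Gamma_add_one hr.ne', Real.rpow_add_one hx.ne']
  have := Real.rpow_pos_of_pos hx r
  field_simp

lemma shareMoment_one_powMeasure_le (δ : Fin J → ℝ) (hr : 0 < r) (j : Fin J)
    (hp : p ∈ PosPrices J) : shareMoment δ (powMeasure r) j p 1 ≤
      logitDenomZero δ * r / p j * shareMoment δ (powMeasure r) j p 0 := by
  have hA := logitDenomZero_pos δ
  have hpj := hp j
  have hone := shareMoment_powMeasure_le δ hr j hp 1
  have hzero := le_shareMoment_powMeasure δ hr j hp 0
  rw [Nat.cast_one, gamma_succ_div_rpow_succ hr hpj] at hone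
  rw [Nat.cast_zero, add_zero] at hzero
  calc _ ≤ _ := hone
    _ = logitDenomZero δ * r / p j *
          (Real.exp (δ j) / logitDenomZero δ * (Real.Gamma r / p j ^ r)) := by field_simp
    _ ≤ _ := by gcongr

lemma shareMoment_zero_powMeasure_le (δ : Fin J → ℝ) (hr : 0 < r) (j : Fin J)
    (hp : p ∈ PosPrices J) : shareMoment δ (powMeasure r) j p 0 ≤
      logitDenomZero δ * p j / r * shareMoment δ (powMeasure r) j p 1 := by
  have hA := logitDenomZero_pos δ
  have hpj := hp j
  have hzero := shareMoment_powMeasure_le δ hr j hp 0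
  have hone := le_shareMoment_powMeasure δ hr j hp 1
  rw [Nat.cast_one, gamma_succ_div_rpow_succ hr hpj] at hone
  rw [Nat.cast_zero, add_zero] at hzero
  calc _ ≤ _ := hzero
    _ = logitDenomZero δ * p j / r *
          (Real.exp (δ j) / logitDenomZero δ * (r / p j * (Real.Gamma r / p j ^ r))) := by
        field_simp
    _ ≤ _ := by gcongr

lemma IsMixing.integral_shareDeriv_le {F : Measure ℝ} (hF : IsMixing F) (δ : Fin J → ℝ)
    (j k : Fin J) (hp : p ∈ PosPrices J) :
    ∫ α, shareDeriv δ j k α p ∂F ≤ shareMoment δ F j p 1 := by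
  refine integral_mono_ae (hF.integrable_shareDeriv δ j k hp)
    (hF.integrable_pow_mul_share δ j hp 1) (hF.pos.mono fun α hα => ?_)
  simpa only [pow_one] using (le_abs_self _).trans (abs_shareDeriv_le δ j k p hα)

lemma shareDeriv_comm (δ : Fin J → ℝ) {j k : Fin J} (hkj : k ≠ j) (α : ℝ) (p : Fin J → ℝ) :
    shareDeriv δ j k α p = shareDeriv δ k j α p := by
  simp only [shareDeriv, if_neg hkj, if_neg hkj.symm, sub_zero, mul_comm (share δ j α p)]

lemma IsMixing.shareMoment_one_le_neg_integral_shareDeriv {F : Measure ℝ} (hF : IsMixing F)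
    (δ : Fin J → ℝ) (j : Fin J) (hp : p ∈ PosPrices J) :
    (logitDenomZero δ)⁻¹ * shareMoment δ F j p 1 ≤ -∫ α, shareDeriv δ j j α p ∂F := by
  rw [← integral_neg, shareMoment, ← integral_const_mul]
  refine integral_mono_ae ((hF.integrable_pow_mul_share δ j hp 1).const_mul _)
    (hF.integrable_shareDeriv δ j j hp).neg (hF.pos.mono fun α hα => ?_)
  have hshare := share_pos δ j α p
  calc (logitDenomZero δ)⁻¹ * (α ^ 1 * share δ j α p)
      ≤ (1 - share δ j α p) * (α ^ 1 * share δ j α p) := by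
        have : 0 < α := hα
        gcongr
        exact inv_le_one_sub_share δ j hα hp
    _ = -shareDeriv δ j j α p := by
        rw [shareDeriv, if_pos rfl]
        ring

lemma pderiv_logDemand_tailH_le_div (δ : Fin J → ℝ) (hr : 0 < r) (j k : Fin J)
    (hp : p ∈ PosPrices J) :
    pderiv k (logDemand (tailH δ r) j) p ≤ logitDenomZero δ * r / p j := by
  have hF := isMixing_powMeasure hr
  rw [pderiv_logDemand_tailH δ hr j k hp, div_le_iff₀ (hF.shareMoment_pos δ j hp 0)]
  exact (hF.integral_shareDeriv_le δ j k hp).trans (shareMoment_one_powMeasure_le δ hr j hp)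

lemma pderiv_logDemand_tailH_le_mul_rpow (δ : Fin J → ℝ) (hr : 0 < r) {j k : Fin J} (hkj : k ≠ j)
    (hp : p ∈ PosPrices J) : pderiv k (logDemand (tailH δ r) j) p ≤
      Real.exp (δ k) * logitDenomZero δ * r / (Real.exp (δ j) * p k ^ (r + 1)) * p j ^ r := by
  have hF := isMixing_powMeasure hr
  have := Real.Gamma_pos_of_pos hr
  have hA := logitDenomZero_pos δ
  have hpj := Real.rpow_pos_of_pos (hp j) r
  have hpk := Real.rpow_pos_of_pos (hp k) (r + 1)
  have hnum := (hF.integral_shareDeriv_le δ k j hp).trans (shareMoment_powMeasure_le δ hr k hp 1)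
  have hdenom := le_shareMoment_powMeasure δ hr j hp 0
  rw [Nat.cast_one, Real.Gamma_add_one hr.ne'] at hnum
  rw [Nat.cast_zero, add_zero] at hdenom
  simp only [pderiv_logDemand_tailH δ hr j k hp, shareDeriv_comm δ hkj]
  calc _ ≤ Real.exp (δ k) * (r * Real.Gamma r / p k ^ (r + 1)) /
          (Real.exp (δ j) / logitDenomZero δ * (Real.Gamma r / p j ^ r)) := by gcongr
    _ = _ := by field_simp

lemma neg_inv_pderiv_logDemand_tailH_self_le (δ : Fin J → ℝ) (hr : 0 < r) (j : Fin J)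
    (hp : p ∈ PosPrices J) :
    -(pderiv j (logDemand (tailH δ r) j) p)⁻¹ ≤ logitDenomZero δ ^ 2 / r * p j := by
  have hF := isMixing_powMeasure hr
  have hA := logitDenomZero_pos δ
  have hpj := hp j
  have hS := hF.shareMoment_pos δ j hp 1
  have hD := neg_pos.2 (hF.integral_shareDeriv_self_neg δ j hp)
  rw [pderiv_logDemand_tailH δ hr j j hp, inv_div, ← div_neg, div_le_iff₀ hD]
  calc _ ≤ logitDenomZero δ * p j / r * shareMoment δ (powMeasure r) j p 1 :=
        shareMoment_zero_powMeasure_le δ hr j hp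
    _ = logitDenomZero δ ^ 2 / r * p j *
          ((logitDenomZero δ)⁻¹ * shareMoment δ (powMeasure r) j p 1) := by field_simp
    _ ≤ _ := by
        gcongr
        exact hF.shareMoment_one_le_neg_integral_shareDeriv δ j hp

end Bounds

section RayDependence

variable {r : ℝ} {p : Fin J → ℝ}

lemma one_mem_posPrices : (1 : Fin J → ℝ) ∈ PosPrices J := fun _ => one_pos

lemma tendsto_pderiv_logDemand_tailH_update_atTop (δ : Fin J → ℝ) (hr : 0 < r) {j k : Fin J}
    (hkj : k ≠ j) (hp : p ∈ PosPrices J) :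
    Tendsto (fun t => pderiv k (logDemand (tailH δ r) j) (Function.update p j t)) atTop
      (𝓝 0) := by
  refine squeeze_zero' ((eventually_gt_atTop 0).mono fun t ht =>
    (pderiv_logDemand_tailH_pos δ hr hkj (update_mem_posPrices hp j ht)).le)
    ((eventually_gt_atTop 0).mono fun t ht => ?_)
    (tendsto_const_nhds (x := logitDenomZero δ * r).div_atTop tendsto_id)
  simpa only [Function.update_self, id] using
    pderiv_logDemand_tailH_le_div δ hr j k (update_mem_posPrices hp j ht)

lemma tendsto_pderiv_logDemand_tailH_update_zero (δ : Fin J → ℝ) (hr : 0 < r) {j k : Fin J}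
    (hkj : k ≠ j) (hp : p ∈ PosPrices J) :
    Tendsto (fun t => pderiv k (logDemand (tailH δ r) j) (Function.update p j t)) (𝓝[>] 0)
      (𝓝 0) := by
  have hrpow : Tendsto (fun t : ℝ => t ^ r) (𝓝[>] 0) (𝓝 0) := by
    simpa only [Real.zero_rpow hr.ne'] using
      (Real.continuousAt_rpow_const 0 r (Or.inr hr.le)).mono_left nhdsWithin_le_nhds
  have hbound := hrpow.const_mul
    (Real.exp (δ k) * logitDenomZero δ * r / (Real.exp (δ j) * p k ^ (r + 1)))
  rw [mul_zero] at hbound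
  refine squeeze_zero' (eventually_mem_nhdsWithin.mono fun t ht =>
    (pderiv_logDemand_tailH_pos δ hr hkj (update_mem_posPrices hp j ht)).le)
    (eventually_mem_nhdsWithin.mono fun t ht => ?_) hbound
  simpa only [Function.update_self, Function.update_of_ne hkj] using
    pderiv_logDemand_tailH_le_mul_rpow δ hr hkj (update_mem_posPrices hp j ht)

theorem exists_gammaOffDiagLimit_pos_and_neg (δ : Fin J → ℝ) (hr : 0 < r) {j k : Fin J}
    (hkj : k ≠ j) : (∃ p ∈ PosPrices J, 0 < gammaOffDiagLimit δ r j k p) ∧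
      ∃ p ∈ PosPrices J, gammaOffDiagLimit δ r j k p < 0 := by
  have hreg := regular_tailH δ hr
  have hpos : ∀ p ∈ PosPrices J, 0 < tailH δ r j p := fun _ => tailH_pos δ hr j
  have hmem (t : ℝ) (ht : 0 < t) := update_mem_posPrices one_mem_posPrices j ht
  have hlimit (t : ℝ) (ht : 0 < t) := (gammaOffDiagLimit_eq δ hr hkj (hmem t ht)).trans
    (offDiagTerm_eq_logDemand hreg hpos (hmem t ht) k)
  have hself (t : ℝ) (ht : 0 < t) :=
    sq_pos_of_neg (pderiv_logDemand_tailH_self_neg δ hr j (hmem t ht))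
  obtain ⟨⟨t, ht, hderiv⟩, t', ht', hderiv'⟩ := exists_deriv_pos_and_neg_of_tendsto_zero
    (fun t ht => pderiv_logDemand_tailH_pos δ hr hkj (hmem t ht))
    (fun t ht => (hasPartialAt_pderiv_logDemand hreg hpos (hmem t ht) k).hasDerivAt_update)
    (tendsto_pderiv_logDemand_tailH_update_zero δ hr hkj one_mem_posPrices)
    (tendsto_pderiv_logDemand_tailH_update_atTop δ hr hkj one_mem_posPrices)
  exact ⟨⟨_, hmem t ht, hlimit t ht ▸ div_pos hderiv (hself t ht)⟩,
    _, hmem t' ht', hlimit t' ht' ▸ div_neg_of_neg_of_pos hderiv' (hself t' ht')⟩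

lemma tendsto_inv_pderiv_logDemand_tailH_update (δ : Fin J → ℝ) (hr : 0 < r) (j : Fin J)
    (hp : p ∈ PosPrices J) :
    Tendsto (fun t => (pderiv j (logDemand (tailH δ r) j) (Function.update p j t))⁻¹) (𝓝[>] 0)
      (𝓝 0) := by
  have hlinear : Tendsto (fun t => logitDenomZero δ ^ 2 / r * t) (𝓝[>] 0) (𝓝 0) := by
    simpa using ((continuous_const_mul (logitDenomZero δ ^ 2 / r)).tendsto 0).mono_left
      nhdsWithin_le_nhds
  suffices Tendsto (fun t => -(pderiv j (logDemand (tailH δ r) j) (Function.update p j t))⁻¹)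
      (𝓝[>] 0) (𝓝 0) by simpa only [neg_neg, neg_zero] using this.neg
  refine squeeze_zero' ?_ ?_ hlinear
  · exact eventually_mem_nhdsWithin.mono fun t ht => neg_nonneg.2 (inv_nonpos.2
      (pderiv_logDemand_tailH_self_neg δ hr j (update_mem_posPrices hp j ht)).le)
  · refine eventually_mem_nhdsWithin.mono fun t ht => ?_
    simpa only [Function.update_self] using
      neg_inv_pderiv_logDemand_tailH_self_le δ hr j (update_mem_posPrices hp j ht)

lemma hasDerivAt_logC_of_offDiagTerm_eq_const (δ : Fin J → ℝ) (hr : 0 < r) {j : Fin J} {c : ℝ}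
    (hconst : ∀ p ∈ PosPrices J, offDiagTerm (tailH δ r) j j p = c) (hp : p ∈ PosPrices J) {t : ℝ}
    (ht : 0 < t) :
    HasDerivAt (fun t => logC δ r j (Function.update p j t)) ((r - c⁻¹) / t) t := by
  have hreg := regular_tailH δ hr
  have hpos : ∀ p ∈ PosPrices J, 0 < tailH δ r j p := fun _ => tailH_pos δ hr j
  have hmem (t : ℝ) (ht : 0 < t) := update_mem_posPrices hp j ht
  have hne (t : ℝ) (ht : 0 < t) := (pderiv_logDemand_tailH_self_neg δ hr j (hmem t ht)).ne
  have hriccati (t : ℝ) (ht : 0 < t) :=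
    (hasPartialAt_pderiv_logDemand hreg hpos (hmem t ht) j).hasDerivAt_update.congr_deriv
      ((div_eq_iff (pow_ne_zero 2 (hne t ht))).1
        ((offDiagTerm_eq_logDemand hreg hpos (hmem t ht) j).symm.trans (hconst _ (hmem t ht))))
  have hself := inv_eq_neg_mul_of_hasDerivAt_mul_sq hne hriccati
    (tendsto_inv_pderiv_logDemand_tailH_update δ hr j hp) ht
  have hlogC := hasDerivAt_logC δ hr j j (hmem t ht)
  rw [← inv_inv (pderiv j (logDemand (tailH δ r) j) _), hself] at hlogC
  simp only [Function.update_idem, Function.update_self, Pi.single_eq_same] at hlogC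
  refine hlogC.congr_deriv ?_
  rw [inv_neg, mul_inv]
  ring

lemma kernelC_le (δ : Fin J → ℝ) (r : ℝ) (j : Fin J) (p : Fin J → ℝ) {u : ℝ} (hu : 0 < u) :
    kernelC δ r j p u ≤ Real.exp (-u) * u ^ (r - 1) := by
  rw [kernelC, mul_comm (Real.exp _)]
  exact div_le_self (by positivity) (le_add_of_nonneg_right (by positivity))

lemma tailC_le_one (δ : Fin J → ℝ) (hr : 0 < r) (j : Fin J) (hp : p ∈ PosPrices J) :
    tailC δ r j p ≤ 1 := by
  rw [tailC, one_div, inv_mul_le_one₀ (Real.Gamma_pos_of_pos hr), Real.Gamma_eq_integral hr]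
  exact setIntegral_mono_on (integrableOn_kernelC δ hr j hp) (Real.GammaIntegral_convergent hr)
    measurableSet_Ioi fun u hu => kernelC_le δ r j p hu

lemma kernelC_update_lt (δ : Fin J → ℝ) (r : ℝ) {j k : Fin J} (hkj : k ≠ j)
    (hp : p ∈ PosPrices J) {t u : ℝ} (ht : p j < t) (hu : 0 < u) :
    kernelC δ r j (Function.update p j t) u < kernelC δ r j p u := by
  have hpj := hp j
  have hratio (l : Fin J) (hl : l ≠ j) :
      Function.update p j t l / Function.update p j t j < p l / p j := by
    rw [Function.update_of_ne hl, Function.update_self]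
    exact div_lt_div_of_pos_left (hp l) hpj ht
  have hle (l : Fin J) :
      Function.update p j t l / Function.update p j t j ≤ p l / p j := by
    obtain rfl | hl := eq_or_ne l j
    · rw [Function.update_self, div_self (hpj.trans ht).ne', div_self hpj.ne']
    · exact (hratio l hl).le
  have hsum : ∑ l, Real.exp (δ l - p l / p j * u) <
      ∑ l, Real.exp (δ l - Function.update p j t l / Function.update p j t j * u) := by
    refine Finset.sum_lt_sum (fun l _ => ?_) ⟨k, Finset.mem_univ k, ?_⟩
    · exact Real.exp_le_exp.2 (sub_le_sub_left (mul_le_mul_of_nonneg_right (hle l) hu.le) _)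
    · exact Real.exp_lt_exp.2 (sub_lt_sub_left (mul_lt_mul_of_pos_right (hratio k hkj) hu) _)
  exact div_lt_div_of_pos_left (by positivity) (by positivity) (by gcongr)

lemma tailC_update_lt (δ : Fin J → ℝ) (hr : 0 < r) {j k : Fin J} (hkj : k ≠ j)
    (hp : p ∈ PosPrices J) {t : ℝ} (ht : p j < t) :
    tailC δ r j (Function.update p j t) < tailC δ r j p := by
  have hint := integrableOn_kernelC δ hr j hp
  have hint' := integrableOn_kernelC δ hr j (update_mem_posPrices hp j ((hp j).trans ht))
  have hne : volume.restrict (Set.Ioi (0 : ℝ)) ≠ 0 := by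
    simp [Measure.restrict_eq_zero]
  have hpos := integral_pos_of_ae_pos hne (hint.sub hint') ((ae_restrict_mem measurableSet_Ioi).mono
    fun u hu => sub_pos.2 (kernelC_update_lt δ r hkj hp ht hu))
  simp only [Pi.sub_apply] at hpos
  rw [integral_sub hint hint', sub_pos] at hpos
  exact mul_lt_mul_of_pos_left hpos (one_div_pos.2 (Real.Gamma_pos_of_pos hr))

theorem exists_gammaDiagLimit_ne (δ : Fin J → ℝ) (hr : 0 < r) {j k : Fin J} (hkj : k ≠ j) :
    ∃ p ∈ PosPrices J, ∃ p' ∈ PosPrices J, gammaDiagLimit δ r j p ≠ gammaDiagLimit δ r j p' := by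
  by_contra! hconst
  have hmem {t : ℝ} (ht : 0 < t) := update_mem_posPrices one_mem_posPrices j ht
  have hcurv (p : Fin J → ℝ) (hp : p ∈ PosPrices J) :
      offDiagTerm (tailH δ r) j j p = offDiagTerm (tailH δ r) j j 1 := by
    have h := hconst p hp 1 one_mem_posPrices
    rwa [gammaDiagLimit_eq δ hr j hp, gammaDiagLimit_eq δ hr j one_mem_posPrices,
      sub_left_inj] at h
  have hlogC : logC δ r j (Function.update 1 j 2) = logC δ r j (Function.update 1 j 1) :=
    eq_of_hasDerivAt_div_of_le
      (fun t ht => hasDerivAt_logC_of_offDiagTerm_eq_const δ hr hcurv one_mem_posPrices ht)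
      (fun t ht => Real.log_nonpos (tailC_pos δ hr j (hmem ht)).le (tailC_le_one δ hr j (hmem ht)))
      two_pos one_pos
  have hlt := Real.log_lt_log (tailC_pos δ hr j (hmem two_pos))
    (tailC_update_lt δ hr hkj one_mem_posPrices one_lt_two)
  have hone : Function.update (1 : Fin J → ℝ) j 1 = 1 := Function.update_eq_self j 1
  rw [hone] at hlogC
  exact hlt.ne hlogC

end RayDependence

end MixedLogit

open MixedLogit in
theorem mainTheorem1 {J : ℕ} (δ : Fin J → ℝ) (M : ℝ) (hM : 0 < M) :
    -- (a) log-normal mixing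
    (∀ μ σ : ℝ, 0 < σ →
      Regular (demand M δ (logNormal μ σ)) ∧
      ∀ p ∈ PosPrices J, ∀ lam : ℕ → ℝ, Tendsto lam atTop atTop → ∀ j : Fin J,
        Tendsto (fun n => diagTerm (demand M δ (logNormal μ σ)) j (lam n • p))
          atTop (𝓝 (-1)) ∧
        ∀ k : Fin J, k ≠ j →
          Tendsto (fun n => offDiagTerm (demand M δ (logNormal μ σ)) j k (lam n • p))
            atTop (𝓝 0)) ∧
    -- (b) gamma mixing with shape `r` and rate `β`
    (∀ r β : ℝ, 0 < r → 0 < β →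
      Regular (demand M δ (gammaMeasure r β)) ∧
      -- `H_j` and `C_j` are finite, `H_j = e^{δ_j} Γ(r) p_j^{-r} C_j`, and the quantities
      -- built from `log C_j` are well defined
      (∀ p ∈ PosPrices J, ∀ j : Fin J,
        IntegrableOn (fun z => z ^ (r - 1) * share δ j z p) (Set.Ioi 0) ∧
        IntegrableOn (kernelC δ r j p) (Set.Ioi 0) ∧
        tailH δ r j p = Real.exp (δ j) * Real.Gamma r * p j ^ (-r) * tailC δ r j p ∧
        0 < tailC δ r j p ∧
        (∀ k : Fin J, HasPartialAt k (logC δ r j) p ∧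
          HasPartialAt j (pderiv k (logC δ r j)) p) ∧
        0 < 1 + zetaTerm δ r j p) ∧
      -- the limits along every ray
      (∀ p ∈ PosPrices J, ∀ lam : ℕ → ℝ, Tendsto lam atTop atTop → ∀ j : Fin J,
        Tendsto (fun n => diagTerm (demand M δ (gammaMeasure r β)) j (lam n • p))
          atTop (𝓝 (gammaDiagLimit δ r j p)) ∧
        ∀ k : Fin J, k ≠ j →
          Tendsto (fun n => offDiagTerm (demand M δ (gammaMeasure r β)) j k (lam n • p))
            atTop (𝓝 (gammaOffDiagLimit δ r j k p))) ∧
      -- no competing inside goods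
      (∀ j : Fin J, (∀ k : Fin J, k = j) →
        (∀ p ∈ PosPrices J, ∀ p' ∈ PosPrices J, tailC δ r j p = tailC δ r j p') ∧
        ∀ p ∈ PosPrices J,
          zetaTerm δ r j p = 0 ∧ chiTerm δ r j p = 0 ∧
          ∀ lam : ℕ → ℝ, Tendsto lam atTop atTop →
            Tendsto (fun n => diagTerm (demand M δ (gammaMeasure r β)) j (lam n • p))
              atTop (𝓝 (-1 + 1 / r))) ∧
      -- with competing inside goods the limits depend on the ray, and the off-diagonal
      -- limit does not vanish identically
      (∀ j k : Fin J, k ≠ j →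
        (∃ p ∈ PosPrices J, ∃ p' ∈ PosPrices J,
          gammaDiagLimit δ r j p ≠ gammaDiagLimit δ r j p') ∧
        (∃ p ∈ PosPrices J, ∃ p' ∈ PosPrices J,
          gammaOffDiagLimit δ r j k p ≠ gammaOffDiagLimit δ r j k p') ∧
        (∃ p ∈ PosPrices J, gammaOffDiagLimit δ r j k p ≠ 0))) := by
  refine ⟨fun μ σ hσ => ⟨(isMixing_logNormal μ σ).regular_demand hM.ne' δ,
    fun p hp lam hlam j => ⟨(tendsto_diagTerm_logNormal hM.ne' μ hσ.ne' δ j hp).comp hlam,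
      fun k _ => (tendsto_offDiagTerm_logNormal hM.ne' μ hσ.ne' δ j k hp).comp hlam⟩⟩,
    fun r β hr hβ => ⟨(isMixing_gammaMeasure hr hβ).regular_demand hM.ne' δ,
      fun p hp j => ⟨integrableOn_rpow_mul_share δ hr j hp, integrableOn_kernelC δ hr j hp,
        tailH_eq_mul_tailC δ hr j hp, tailC_pos δ hr j hp,
        fun k => ⟨hasPartialAt_logC δ hr j k hp, hasPartialAt_pderiv_logC δ hr j k hp⟩,
        one_add_zetaTerm_pos δ hr j hp⟩,
      fun p hp lam hlam j => ⟨(tendsto_diagTerm_gamma hM.ne' δ hr hβ j hp).comp hlam,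
        fun k hkj => (tendsto_offDiagTerm_gamma hM.ne' δ hr hβ hkj hp).comp hlam⟩,
      fun j hj => ⟨fun p hp p' hp' => tailC_eq_of_unique δ r hj hp hp',
        fun p hp => ⟨zetaTerm_of_unique δ r hj hp, chiTerm_of_unique δ r hj hp, fun lam hlam =>
          gammaDiagLimit_of_unique δ r hj hp ▸
            (tendsto_diagTerm_gamma hM.ne' δ hr hβ j hp).comp hlam⟩⟩,
      fun j k hkj => ⟨exists_gammaDiagLimit_ne δ hr hkj, ?_⟩⟩⟩
  obtain ⟨⟨p, hp, hpos⟩, p', hp', hneg⟩ := exists_gammaOffDiagLimit_pos_and_neg δ hr hkj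
  exact ⟨⟨p, hp, p', hp', (hneg.trans hpos).ne'⟩, p, hp, hpos.ne'⟩
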